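/- For a set $A$ in a topological space let $\chi^*_A$ be $1$ on the interior of $A$, $1/2$ on $\partial A$ and $0$ outside $\overline A$. In the sums below, $p^m$ runs over all prime powers ($p$ prime, $m\ge 1$). Let $$\psi(x)=\sum_{p^m}\chi^*_{[0,x]}(p^m)\log p$$ be the normalized Chebyshev function. For $c>0$ and $\varepsilon>0$ let $$\ell_{c,\varepsilon}(\xi)=\frac{c}{\sinh c}\,\frac{\sin\sqrt{(\xi\varepsilon)^2-c^2}}{\sqrt{(\xi\varepsilon)^2-c^2}},\qquad \lambda_{c,\varepsilon}=\ell_{c,\varepsilon}(i/2),$$ $$\eta_{c,\varepsilon}(t)=\chi^*_{[-\varepsilon,\varepsilon]}(t)\,\frac{c}{2\varepsilon\sinh c}\,I_0\bigl(c\sqrt{1-(t/\varepsilon)^2}\bigr),\qquad I_0(t)=\sum_{n\ge 0}\frac{(t/2)^{2n}}{(n!)^2},$$ so that $\eta_{c,\varepsilon}$ is the Fourier transform of $\ell_{c,\varepsilon}$, and put $$\varphi_{x,c,\varepsilon}(t)=\frac1{\lambda_{c,\varepsilon}}\int_0^{\log x}e^{y/2}\,\eta_{c,\varepsilon}(t-y)\,dy,\qquad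 \psi_{c,\varepsilon}(x)=\sum_{p^m}\frac{\log p}{p^{m/2}}\,\varphi_{x,c,\varepsilon}(m\log p).$$ Let $\mu_{c,\varepsilon}$ be the odd function on $\mathbb R$ with $\mu_{c,\varepsilon}(t)=-\int_{-\infty}^t\eta_{c,\varepsilon}(\tau)\,d\tau$ for $t<0$ (so $\mu_{c,\varepsilon}(0)=0$), let $\nu_{c,\varepsilon}(t)=\int_{-\infty}^t\mu_{c,\varepsilon}(\tau)\,d\tau$, write $\mu_c=\mu_{c,1}$ and $\nu_c=\nu_{c,1}$, and let $(\mu_c)_+(\alpha)=\lim_{t\searrow\alpha}\mu_c(t)$. Let $c>0$, $0\le\alpha<1$, $x>100$ and $0<\varepsilon<10^{-2}$ be such that $$B=\frac{\varepsilon x e^{-\varepsilon}\,|\nu_c(\alpha)|}{2(\mu_c)_+(\alpha)}>1,$$ and define $$A(x,c,\varepsilon,\alpha)=e^{2\varepsilon}\log(e^{\varepsilon}x)\Bigl[\frac{2\varepsilon x\,|\nu_c(\alpha)|}{\log B}+2.01\,\varepsilon\sqrt x+\tfrac12\log\log(2x^2)\Bigr].$$ Then $$\psi(e^{-\alpha\varepsilon}x)\le\psi_{c,\varepsilon}(x)+A(x,c,\varepsilon,\alpha)\qquad\text{and}\qquad\psi(e^{\alpha\varepsilon}x)\ge\psi_{c,\varepsilon}(x)-A(x,c,\varepsilon,\alpha).$$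 -/

import Mathlib

noncomputable section

/-- The normalized characteristic function `χ*_A` of a subset `A` of a topological space:
`1` in the interior of `A`, `1/2` on the boundary, `0` outside the closure. -/
def chiStar {X : Type*} [TopologicalSpace X] (A : Set X) (x : X) : ℝ :=
  open Classical in if x ∈ frontier A then 1 / 2 else if x ∈ A then 1 else 0

/-- The normalized Chebyshev function: the sum of `log p` over all prime powers `p ^ m ≤ x`
with `m ≥ 1`, where a prime power equal to `x` is counted with weight `1/2`. -/
def psiStar (x : ℝ) : ℝ :=
  ∑' q : Nat.Primes × ℕ+,
    chiStar (Set.Icc 0 x) ((q.1 : ℝ) ^ (q.2 : ℕ)) * Real.log (q.1 : ℝ)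

/-- The entire function `w ↦ sin w / w`, with value `1` at `0`. -/
def complexSinc (w : ℂ) : ℂ :=
  if w = 0 then 1 else Complex.sin w / w

/-- The Logan function. As `complexSinc` is even, the choice of the square root is immaterial. -/
def logan (c ε : ℝ) (ξ : ℂ) : ℂ :=
  (c : ℂ) / Complex.sinh c * complexSinc (((ξ * ε) ^ 2 - (c : ℂ) ^ 2) ^ (1 / 2 : ℂ))

/-- The real number `λ_{c,ε}`, the value of the Logan function at `i / 2`. -/
def loganLambda (c ε : ℝ) : ℝ :=
  (logan c ε (Complex.I / 2)).re

/-- The modified Bessel function of the first kind of order `0`. -/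
def besselI0 (t : ℝ) : ℝ :=
  ∑' n : ℕ, (t / 2) ^ (2 * n) / ((n.factorial : ℝ) ^ 2)

/-- The Fourier transform of the Logan function. -/
def eta (c ε t : ℝ) : ℝ :=
  chiStar (Set.Icc (-ε) ε) t *
    (c / (2 * ε * Real.sinh c) * besselI0 (c * √(1 - (t / ε) ^ 2)))

/-- The function `φ_{x,c,ε}`: the convolution of `χ_{[0, log x]} exp(·/2)` with `η_{c,ε}`,
divided by `λ_{c,ε}`. -/
def phiKernel (x c ε t : ℝ) : ℝ :=
  1 / loganLambda c ε *
    ∫ y, (Set.Icc 0 (Real.log x)).indicator (fun s => Real.exp (s / 2)) y * eta c ε (t - y)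

/-- The modified Chebyshev function `ψ_{c,ε}`. -/
def psiMod (c ε x : ℝ) : ℝ :=
  ∑' q : Nat.Primes × ℕ+,
    Real.log (q.1 : ℝ) / (q.1 : ℝ) ^ (((q.2 : ℕ) : ℝ) / 2) *
      phiKernel x c ε (((q.2 : ℕ) : ℝ) * Real.log (q.1 : ℝ))

/-- The odd function `μ_{c,ε}`, equal to `-∫_{-∞}^t η_{c,ε}` for `t < 0`. -/
def muFun (c ε t : ℝ) : ℝ :=
  if t < 0 then -∫ τ in Set.Iic t, eta c ε τ
  else if 0 < t then ∫ τ in Set.Iic (-t), eta c ε τ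
  else 0

/-- The function `ν_{c,ε}(t) = ∫_{-∞}^t μ_{c,ε}`. -/
def nuFun (c ε t : ℝ) : ℝ :=
  ∫ τ in Set.Iic t, muFun c ε τ

/-- The quantity `B`. Here `μ_c = μ_{c,1}`, `ν_c = ν_{c,1}`, and `(μ_c)_+ (α)` is the right-hand
limit of `μ_c` at `α` (it is `μ_c (α)` for `0 < α`, and `1/2` for `α = 0`). -/
def boundB (x c ε α : ℝ) : ℝ :=
  ε * x * Real.exp (-ε) * |nuFun c 1 α| / (2 * Function.rightLim (muFun c 1) α)

/-- The error bound `A(x,c,ε,α)`. -/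
def boundA (x c ε α : ℝ) : ℝ :=
  Real.exp (2 * ε) * Real.log (Real.exp ε * x) *
    (2 * ε * x * |nuFun c 1 α| / Real.log (boundB x c ε α)
      + 2.01 * ε * √x + 1 / 2 * Real.log (Real.log (2 * x ^ 2)))

end

/-! For `t ≥ ε` the factor `e^{-t/2}` turns `φ` into a smoothed cutoff: `e^{-t/2} φ(t) = K(t - log
x)` with `K(u) = λ⁻¹ ∫_{s > u} e^{-s/2} η(s) ds`. Here `λ = ∫ e^{-s/2} η(s) ds`, a Laplace transform
of `I₀` obtained from power series in `integral_cosh_mul_besselI0`, so `K` falls from 1 at `-ε` to 0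
at `ε`. Since `log 2 > ε`, every prime power is covered, and `psiMod_eq` writes `ψ_{c,ε}(x)` as the
sum of `log p · K(log(p^m / x))`.

Both claims compare `K` with a sharp cutoff, and each needs an estimate in one direction only. The
cutoff at `e^{-αε} x` exceeds `K` only on `[e^{-ε} x, e^{-αε} x]`, by at most `e^{ε/2}` times the
mass of `η` beyond `|log(p^m / x)|`; `K` exceeds the cutoff at `e^{αε} x` only on `[e^{αε} x, e^ε
x]`, by at most such a mass. In units of `ε` this mass is `etaTail c`, whose value at `α` is
`(μ_c)_+(α)` and whose integral over `[α, 1]` is `|ν_c(α)|`. So `A` has to bound a weighted sum of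
`log p` over the prime powers in a short interval.

Proper powers are counted trivially (`tsum_primePow_le`). For the primes, Selberg's sieve is applied
within the odd integers. The weight is monotone on its interval, so its sum over the odd multiples
of `D` differs from `W / (2D)` by at most its maximum `M`, where `W` is its integral. The sieve of
level `N` gives `W / (2S) + M (H / S)²`, where `S` and `H` are the sums of `1/φ(k)` and `σ(k)/φ(k)`
over odd squarefree `k ≤ N`. By the bounds `S ≥ ½ log(2(N+1)) + ¼` and `H ≤ N` (for `N ≥ 15`), a
suitable level turns this into `2 M y / log(y/2)` with `y = W / M` (`exists_selberg_level`).
Inserting `W ≤ e^ε ε x |ν_c(α)|` and `M = (μ_c)_+(α)` gives the leading term of `A`; `B` is `y/2` up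
to a factor `e^{2ε}`. -/

section

/-! ### Selberg's weights for odd integers and their quadratic form -/

open Finset ArithmeticFunction

/-- The odd squarefree positive integers up to `N`. -/
def oddSquarefree (N : ℕ) : Finset ℕ :=
  (Finset.Icc 1 N).filter fun m => m % 2 = 1 ∧ Squarefree m

/-- The sum of `1 / φ(k)` over the odd squarefree integers `k ≤ N`. -/
noncomputable def selbergMass (N : ℕ) : ℝ :=
  ∑ k ∈ oddSquarefree N, 1 / (k.totient : ℝ)

/-- The sum of `σ(k) / φ(k)` over the odd squarefree integers `k ≤ N`. -/
noncomputable def sigmaTotientSum (N : ℕ) : ℝ :=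
  ∑ k ∈ oddSquarefree N, ((∑ d ∈ k.divisors, d : ℕ) : ℝ) / (k.totient : ℝ)

/-- The optimal weights of Selberg's upper bound sieve of level `N` for odd integers. -/
noncomputable def selbergWeight (N d : ℕ) : ℝ :=
  (moebius d : ℝ) * d / selbergMass N * ∑ k ∈ oddSquarefree N with d ∣ k, 1 / (k.totient : ℝ)

theorem mem_oddSquarefree {N k : ℕ} :
    k ∈ oddSquarefree N ↔ (1 ≤ k ∧ k ≤ N) ∧ k % 2 = 1 ∧ Squarefree k := by
  simp [oddSquarefree]

theorem mem_oddSquarefree_of_dvd {N k d : ℕ} (hk : k ∈ oddSquarefree N) (hd : d ∣ k) :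
    d ∈ oddSquarefree N := by
  rw [mem_oddSquarefree] at hk ⊢
  obtain ⟨⟨h1, h2⟩, h3, h4⟩ := hk
  refine ⟨⟨Nat.pos_of_dvd_of_pos hd h1, (Nat.le_of_dvd h1 hd).trans h2⟩, ?_,
    h4.squarefree_of_dvd hd⟩
  exact Nat.odd_iff.mp ((Nat.odd_iff.mpr h3).of_dvd_nat hd)

theorem one_mem_oddSquarefree {N : ℕ} (hN : 1 ≤ N) : 1 ∈ oddSquarefree N := by
  simp [mem_oddSquarefree, hN]

theorem totient_pos_of_mem_oddSquarefree {N k : ℕ} (hk : k ∈ oddSquarefree N) :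
    (0 : ℝ) < k.totient := by
  exact_mod_cast Nat.totient_pos.mpr (mem_oddSquarefree.mp hk).1.1

theorem one_le_selbergMass {N : ℕ} (hN : 1 ≤ N) : 1 ≤ selbergMass N := by
  have := Finset.single_le_sum (f := fun k : ℕ => 1 / (k.totient : ℝ))
    (fun i _ => by positivity) (one_mem_oddSquarefree hN)
  simpa [selbergMass] using this

theorem selbergWeight_one {N : ℕ} (hN : 1 ≤ N) : selbergWeight N 1 = 1 := by
  have := one_le_selbergMass hN
  have h : (∑ k ∈ oddSquarefree N with 1 ∣ k, 1 / (k.totient : ℝ)) = selbergMass N := by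
    simp [selbergMass]
  rw [selbergWeight, h]
  simp only [moebius_apply_one, Int.cast_one, Nat.cast_one, mul_one]
  field_simp

theorem sum_filter_dvd_oddSquarefree {N k : ℕ} (hk : k ∈ oddSquarefree N) (f : ℕ → ℝ) :
    ∑ d ∈ oddSquarefree N with d ∣ k, f d = ∑ d ∈ k.divisors, f d := by
  refine Finset.sum_congr ?_ fun _ _ => rfl
  ext d
  have hk0 : k ≠ 0 := by have := (mem_oddSquarefree.mp hk).1.1; omega
  simp only [Finset.mem_filter, Nat.mem_divisors]
  exact ⟨fun h => ⟨h.2, hk0⟩, fun h => ⟨mem_oddSquarefree_of_dvd hk h.1, h.1⟩⟩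

/-- Exchanging the sums collects `d / φ(k)` over the divisors `d` of `k`, which is `σ(k) / φ(k)`.
This controls the remainder of the sieve. -/
theorem sum_abs_selbergWeight_le {N : ℕ} (hN : 1 ≤ N) :
    ∑ d ∈ oddSquarefree N, |selbergWeight N d| ≤ sigmaTotientSum N / selbergMass N := by
  have hS := one_le_selbergMass hN
  have hle : ∀ d ∈ oddSquarefree N, |selbergWeight N d| ≤
      (∑ k ∈ oddSquarefree N, if d ∣ k then (d : ℝ) / (k.totient : ℝ) else 0)
        / selbergMass N := by
    intro d _
    have h0 : 0 ≤ ∑ k ∈ oddSquarefree N with d ∣ k, 1 / (k.totient : ℝ) :=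
      Finset.sum_nonneg fun _ _ => by positivity
    have hmu : |(moebius d : ℝ)| ≤ 1 := by exact_mod_cast abs_moebius_le_one
    rw [selbergWeight, abs_mul, abs_of_nonneg h0, abs_div, abs_mul,
      abs_of_pos (by linarith : 0 < selbergMass N), Nat.abs_cast, ← Finset.sum_filter,
      div_mul_eq_mul_div]
    gcongr
    calc |(moebius d : ℝ)| * d * ∑ k ∈ oddSquarefree N with d ∣ k, 1 / (k.totient : ℝ)
        ≤ 1 * d * ∑ k ∈ oddSquarefree N with d ∣ k, 1 / (k.totient : ℝ) := by gcongr
      _ = _ := by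
        rw [one_mul, Finset.mul_sum]
        exact Finset.sum_congr rfl fun _ _ => by ring
  refine (Finset.sum_le_sum hle).trans (le_of_eq ?_)
  rw [← Finset.sum_div, Finset.sum_comm, sigmaTotientSum]
  congr 1
  refine Finset.sum_congr rfl fun k hk => ?_
  rw [← Finset.sum_filter, sum_filter_dvd_oddSquarefree hk (fun d => (d : ℝ) / (k.totient : ℝ)),
    ← Finset.sum_div]
  push_cast
  rfl

/-- For squarefree `j`, the sum of `μ(d)` over `k ∣ d ∣ j` is `μ(k)` if `j = k` and `0` otherwise. -/
theorem sum_moebius_between {k j : ℕ} (hj : Squarefree j) (hk : k ≠ 0) :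
    ∑ d ∈ j.divisors with k ∣ d, (moebius d : ℝ) = if j = k then (moebius k : ℝ) else 0 := by
  have hj0 : j ≠ 0 := hj.ne_zero
  by_cases hkj : k ∣ j
  · obtain ⟨m, rfl⟩ := hkj
    have hm0 : m ≠ 0 := by rintro rfl; simp at hj0
    have hcop := (Nat.squarefree_mul_iff.mp hj).1
    have hset : ((k * m).divisors.filter fun d => k ∣ d) = m.divisors.image (k * ·) := by
      ext d
      simp only [Finset.mem_filter, Nat.mem_divisors, Finset.mem_image]
      constructor
      · rintro ⟨⟨h1, _⟩, ⟨e, rfl⟩⟩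
        exact ⟨e, ⟨Nat.dvd_of_mul_dvd_mul_left (Nat.pos_of_ne_zero hk) h1, hm0⟩, rfl⟩
      · rintro ⟨e, ⟨h1, _⟩, rfl⟩
        exact ⟨⟨Nat.mul_dvd_mul_left k h1, hj0⟩, Dvd.intro e rfl⟩
    rw [hset, Finset.sum_image (fun a _ b _ h => Nat.eq_of_mul_eq_mul_left
      (Nat.pos_of_ne_zero hk) h)]
    have h1 : ∀ e ∈ m.divisors, (moebius (k * e) : ℝ) = moebius k * moebius e := by
      intro e he
      rw [isMultiplicative_moebius.map_mul_of_coprime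
        (hcop.coprime_dvd_right (Nat.dvd_of_mem_divisors he))]
      push_cast; rfl
    rw [Finset.sum_congr rfl h1, ← Finset.mul_sum]
    have h2 : (∑ e ∈ m.divisors, (moebius e : ℝ)) = if m = 1 then 1 else 0 := by
      have := congrArg (fun f : ArithmeticFunction ℤ => f m) moebius_mul_coe_zeta
      simp only [coe_mul_zeta_apply, one_apply] at this
      exact_mod_cast this
    rw [h2]
    by_cases hm : m = 1
    · simp [hm]
    · have : k * m ≠ k := by
        intro h
        apply hm
        exact Nat.eq_of_mul_eq_mul_left (Nat.pos_of_ne_zero hk) (by simpa using h)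
      simp [hm, this]
  · have : j ≠ k := by rintro rfl; exact hkj dvd_rfl
    rw [if_neg this, Finset.filter_false_of_mem, Finset.sum_empty]
    intro d hd hkd
    exact hkj (hkd.trans (Nat.dvd_of_mem_divisors hd))

/-- These are the variables that diagonalize the quadratic form. By Möbius inversion over `k ∣ d ∣
j` only `j = k` survives from the definition of the weight. -/
theorem sum_selbergWeight_div {N k : ℕ} (hk : k ∈ oddSquarefree N) :
    ∑ d ∈ oddSquarefree N with k ∣ d, selbergWeight N d / d
      = (moebius k : ℝ) / (k.totient * selbergMass N) := by
  have hk0 : k ≠ 0 := by have := (mem_oddSquarefree.mp hk).1.1; omega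
  have h1 : ∀ d ∈ oddSquarefree N, selbergWeight N d / d =
      ∑ j ∈ oddSquarefree N, if d ∣ j then
        (moebius d : ℝ) * (1 / (j.totient * selbergMass N)) else 0 := by
    intro d hd
    have hd0 : (d : ℝ) ≠ 0 := by
      have := (mem_oddSquarefree.mp hd).1.1
      positivity
    rw [← Finset.sum_filter, ← Finset.mul_sum, selbergWeight]
    have : ∑ j ∈ oddSquarefree N with d ∣ j, 1 / ((j.totient : ℝ) * selbergMass N)
        = (∑ j ∈ oddSquarefree N with d ∣ j, 1 / (j.totient : ℝ)) / selbergMass N := by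
      rw [Finset.sum_div]
      exact Finset.sum_congr rfl fun _ _ => by rw [div_div]
    rw [this]
    field_simp
  rw [Finset.sum_congr rfl fun d hd => h1 d (Finset.mem_filter.mp hd).1, Finset.sum_comm]
  have h2 : ∀ j ∈ oddSquarefree N, (∑ d ∈ oddSquarefree N with k ∣ d, if d ∣ j then
        (moebius d : ℝ) * (1 / (j.totient * selbergMass N)) else 0)
      = if j = k then (moebius k : ℝ) * (1 / (j.totient * selbergMass N)) else 0 := by
    intro j hj
    rw [← Finset.sum_filter, Finset.filter_filter]
    simp_rw [and_comm (a := k ∣ _)]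
    rw [← Finset.filter_filter, ← Finset.sum_mul]
    have h3 := sum_moebius_between (k := k) (mem_oddSquarefree.mp hj).2.2 hk0
    rw [Finset.sum_filter, sum_filter_dvd_oddSquarefree hj, ← Finset.sum_filter, h3]
    split_ifs <;> simp
  rw [Finset.sum_congr rfl h2, Finset.sum_ite_eq' (oddSquarefree N) k, if_pos hk]
  ring

/-- `1 / lcm(d, e) = gcd(d, e) / (d e)`, and the gcd is the sum of `φ(k)` over its divisors `k`. -/
theorem inv_lcm_eq_sum_totient {N d e : ℕ} (hd : d ∈ oddSquarefree N) (he : e ∈ oddSquarefree N) :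
    1 / (Nat.lcm d e : ℝ) = ∑ k ∈ oddSquarefree N,
      if k ∣ d ∧ k ∣ e then (k.totient : ℝ) * (1 / d) * (1 / e) else 0 := by
  have hd0 := (mem_oddSquarefree.mp hd).1.1
  have he0 := (mem_oddSquarefree.mp he).1.1
  have hg : Nat.gcd d e ∈ oddSquarefree N := mem_oddSquarefree_of_dvd hd (Nat.gcd_dvd_left d e)
  simp_rw [← Nat.dvd_gcd_iff]
  rw [← Finset.sum_filter, sum_filter_dvd_oddSquarefree hg
    (fun k => (k.totient : ℝ) * (1 / d) * (1 / e)), ← Finset.sum_mul, ← Finset.sum_mul]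
  have h1 : (∑ k ∈ (Nat.gcd d e).divisors, (k.totient : ℝ)) = Nat.gcd d e := by
    exact_mod_cast Nat.sum_totient (Nat.gcd d e)
  have h2 : (Nat.gcd d e : ℝ) * Nat.lcm d e = d * e := by exact_mod_cast Nat.gcd_mul_lcm d e
  have h3 : (0 : ℝ) < Nat.lcm d e := by exact_mod_cast Nat.lcm_pos hd0 he0
  have h4 : (0 : ℝ) < d := by exact_mod_cast hd0
  have h5 : (0 : ℝ) < e := by exact_mod_cast he0
  rw [h1]
  field_simp
  linarith

/-- The form equals `∑ φ(k) y_k²` with `y_k = μ(k) / (φ(k) S)`, hence `S / S²`. This is the main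
term of the sieve. -/
theorem sum_sum_selbergWeight_mul_div_lcm {N : ℕ} (hN : 1 ≤ N) :
    ∑ d ∈ oddSquarefree N, ∑ e ∈ oddSquarefree N,
      selbergWeight N d * selbergWeight N e * (1 / (Nat.lcm d e : ℝ)) = 1 / selbergMass N := by
  have hS := one_le_selbergMass hN
  have h1 : ∀ d ∈ oddSquarefree N, ∀ e ∈ oddSquarefree N,
      selbergWeight N d * selbergWeight N e * (1 / (Nat.lcm d e : ℝ)) =
      ∑ k ∈ oddSquarefree N, (k.totient : ℝ) * (if k ∣ d then selbergWeight N d / d else 0)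
        * (if k ∣ e then selbergWeight N e / e else 0) := by
    intro d hd e he
    rw [inv_lcm_eq_sum_totient hd he, Finset.mul_sum]
    refine Finset.sum_congr rfl fun k _ => ?_
    by_cases h1 : k ∣ d <;> by_cases h2 : k ∣ e <;> simp [h1, h2]
    ring
  rw [Finset.sum_congr rfl fun d hd => Finset.sum_congr rfl fun e he => h1 d hd e he]
  simp_rw [Finset.sum_comm (s := oddSquarefree N) (t := oddSquarefree N)
    (f := fun e k => (k.totient : ℝ) * _ * (if k ∣ e then selbergWeight N e / e else 0))]
  rw [Finset.sum_comm]
  have h2 : ∀ k ∈ oddSquarefree N, (∑ d ∈ oddSquarefree N, ∑ e ∈ oddSquarefree N,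
      (k.totient : ℝ) * (if k ∣ d then selbergWeight N d / d else 0)
        * (if k ∣ e then selbergWeight N e / e else 0))
      = 1 / (k.totient : ℝ) * (1 / selbergMass N ^ 2) := by
    intro k hk
    have hφ := totient_pos_of_mem_oddSquarefree hk
    simp_rw [← Finset.mul_sum, ← Finset.sum_filter]
    rw [sum_selbergWeight_div hk, ← Finset.sum_mul, ← Finset.mul_sum, ← Finset.sum_filter,
      sum_selbergWeight_div hk]
    have hmu : (moebius k : ℝ) ^ 2 = 1 := by
      have := moebius_sq_eq_one_of_squarefree (mem_oddSquarefree.mp hk).2.2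
      exact_mod_cast this
    field_simp
    linarith
  rw [Finset.sum_congr rfl h2, ← Finset.sum_mul]
  change selbergMass N * _ = _
  field_simp

/-! ### Equidistribution of a monotone weight over odd multiples, and the sieve -/

open MeasureTheory in
/-- The sum of a decreasing function over the integers differs from its integral
by at most its maximum. -/
theorem abs_tsum_int_sub_integral_le {f : ℝ → ℝ} {a b M : ℝ} (hanti : AntitoneOn f (Set.Ici a))
    (hlt : ∀ t < a, f t = 0) (hgt : ∀ t, b < t → f t = 0) (hM : ∀ t, f t ≤ M) :
    |∑' k : ℤ, f k - ∫ t, f t| ≤ M := by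
  have hnn : ∀ t, 0 ≤ f t := by
    intro t
    rcases lt_or_ge t a with h | h
    · exact (hlt t h).ge
    · rw [← hgt (max t (b + 1)) (lt_of_lt_of_le (by linarith) (le_max_right _ _))]
      exact hanti h (h.trans (le_max_left _ _)) (le_max_left _ _)
  obtain ⟨J, hJ⟩ := exists_nat_gt (b - ⌈a⌉)
  set m : ℝ := (⌈a⌉ : ℝ) with hm
  have ham : a ≤ m := Int.le_ceil a
  have hma : m < a + 1 := Int.ceil_lt_add_one a
  have hJ0 : (0 : ℝ) ≤ J := Nat.cast_nonneg J
  have hsum : ∑' k : ℤ, f k = ∑ i ∈ Finset.range (J + 1), f (m + i) := by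
    rw [tsum_eq_sum (s := (Finset.range (J + 1)).image fun i : ℕ => ⌈a⌉ + (i : ℤ))]
    · rw [Finset.sum_image (by intro i _ j _ h; simpa using h)]
      refine Finset.sum_congr rfl fun i _ => ?_
      push_cast
      rfl
    · intro k hk
      by_contra hne
      apply hk
      have h1 : a ≤ k := by
        by_contra h
        exact hne (hlt _ (not_le.mp h))
      have h2 : (k : ℝ) ≤ b := by
        by_contra h
        exact hne (hgt _ (not_le.mp h))
      have h3 : ⌈a⌉ ≤ k := Int.ceil_le.mpr h1
      have h4 : k < ⌈a⌉ + J := by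
        have : (k : ℝ) < ((⌈a⌉ + J : ℤ) : ℝ) := by push_cast; linarith
        exact_mod_cast this
      rw [Finset.mem_image]
      exact ⟨(k - ⌈a⌉).toNat, by rw [Finset.mem_range]; omega, by omega⟩
  have hint : ∀ u v : ℝ, a ≤ u → a ≤ v → IntervalIntegrable f volume u v := by
    intro u v hu hv
    refine (hanti.mono ?_).intervalIntegrable
    intro t ht
    exact (le_min hu hv).trans ht.1
  have hI : ∫ t, f t = (∫ t in a..m, f t) + ∫ t in m..(m + J), f t := by
    rw [intervalIntegral.integral_add_adjacent_intervals (hint _ _ le_rfl ham)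
      (hint _ _ ham (by linarith)), intervalIntegral.integral_of_le (by linarith),
      ← integral_Icc_eq_integral_Ioc]
    rw [setIntegral_eq_integral_of_forall_compl_eq_zero]
    intro t ht
    rw [Set.mem_Icc, not_and_or, not_le, not_le] at ht
    rcases ht with h | h
    · exact hlt t h
    · exact hgt t (by linarith)
  -- The gap between `a` and the first integer after it has length below 1, so it costs at most `M`.
  have hamM : (∫ t in a..m, f t) ≤ M := by
    have hM0 : 0 ≤ M := (hnn 0).trans (hM 0)
    calc (∫ t in a..m, f t) ≤ ∫ _ in a..m, M :=
          intervalIntegral.integral_mono_on ham (hint _ _ le_rfl ham) (by simp) fun t _ => hM t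
      _ = (m - a) * M := by simp
      _ ≤ 1 * M := by gcongr; linarith
      _ = M := one_mul M
  have ham0 : 0 ≤ ∫ t in a..m, f t := intervalIntegral.integral_nonneg ham fun t _ => hnn t
  have hanti' : AntitoneOn f (Set.Icc m (m + J)) :=
    hanti.mono fun t ht => ham.trans ht.1
  have hup := hanti'.sum_le_integral
  have hlo := hanti'.integral_le_sum
  have hs1 := Finset.sum_range_succ' (fun i : ℕ => f (m + i)) J
  have hs2 := Finset.sum_range_succ (fun i : ℕ => f (m + i)) J
  rw [hsum, hI, abs_le]
  constructor
  · rw [hs2]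
    have := hnn (m + J)
    linarith
  · rw [hs1]
    have := hM (m + (0 : ℕ))
    linarith

-- The odd multiples of `D` form a progression of step `2D`, so rescaling gives density `1 / (2D)`.
-- One-sided monotonicity keeps the error at `M` instead of the total variation `2M`.
open MeasureTheory in
theorem abs_tsum_odd_multiples_sub_le_of_antitoneOn {w : ℝ → ℝ} {a b M : ℝ}
    (hanti : AntitoneOn w (Set.Ici a)) (hlt : ∀ t < a, w t = 0) (hgt : ∀ t, b < t → w t = 0)
    (hM : ∀ t, w t ≤ M) {D : ℕ} (hD : 0 < D) :
    |∑' k : ℤ, w (((D * (2 * k + 1) : ℤ)) : ℝ) - (∫ t, w t) / 2 * (1 / D)| ≤ M := by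
  have hD' : (0 : ℝ) < D := by exact_mod_cast hD
  have h := abs_tsum_int_sub_integral_le (f := fun s => w (2 * D * s + D))
    (a := (a - D) / (2 * D)) (b := (b - D) / (2 * D)) (M := M) ?_ ?_ ?_ (fun _ => hM _)
  · have hI : ∫ s, w (2 * D * s + D) = (∫ t, w t) / 2 * (1 / D) := by
      rw [Measure.integral_comp_mul_left (fun t => w (t + D)) (2 * D : ℝ),
        integral_add_right_eq_self, abs_of_pos (by positivity), smul_eq_mul]
      field_simp
    rw [hI] at h
    convert h using 5 with k
    push_cast
    ring_nf
  · intro s hs t ht hst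
    rw [Set.mem_Ici, div_le_iff₀ (by positivity)] at hs ht
    exact hanti (by rw [Set.mem_Ici]; linarith) (by rw [Set.mem_Ici]; linarith) (by gcongr)
  · intro t ht
    rw [lt_div_iff₀ (by positivity)] at ht
    exact hlt _ (by linarith)
  · intro t ht
    rw [div_lt_iff₀ (by positivity)] at ht
    exact hgt _ (by linarith)

open MeasureTheory in
theorem abs_tsum_odd_multiples_sub_le_of_monotoneOn {w : ℝ → ℝ} {a b M : ℝ}
    (hmono : MonotoneOn w (Set.Iic b)) (hlt : ∀ t < a, w t = 0) (hgt : ∀ t, b < t → w t = 0)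
    (hM : ∀ t, w t ≤ M) {D : ℕ} (hD : 0 < D) :
    |∑' k : ℤ, w (((D * (2 * k + 1) : ℤ)) : ℝ) - (∫ t, w t) / 2 * (1 / D)| ≤ M := by
  have h := abs_tsum_odd_multiples_sub_le_of_antitoneOn (w := fun t => w (-t)) (a := -b) (b := -a)
    (M := M) ?_ (fun t ht => hgt _ (by linarith)) (fun t ht => hlt _ (by linarith))
    (fun _ => hM _) hD
  · rw [integral_neg_eq_self] at h
    -- Reflection sends `D (2k + 1)` to the odd multiple with index `-1 - k`.
    rw [← (Equiv.subLeft (-1 : ℤ)).tsum_eq]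
    convert h using 6 with k
    simp only [Equiv.subLeft_apply]
    push_cast
    ring_nf
  · intro s hs t ht hst
    rw [Set.mem_Ici] at hs ht
    exact hmono (by rw [Set.mem_Iic]; linarith) (by rw [Set.mem_Iic]; linarith) (by linarith)

/-- Selberg's upper bound sieve for the odd primes, with a weight function. -/
theorem sum_primes_le_selberg {w : ℝ → ℝ} {a b M W : ℝ} {N : ℕ} (hN : 1 ≤ N)
    (hw : ∀ t, 0 ≤ w t) (hsupp : ∀ t, w t ≠ 0 → a ≤ t ∧ t ≤ b)
    (hdisc : ∀ D : ℕ, 0 < D →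
      |∑' k : ℤ, w (((D * (2 * k + 1) : ℤ)) : ℝ) - W / 2 * (1 / D)| ≤ M)
    (P : Finset ℕ) (hP : ∀ p ∈ P, p.Prime ∧ N < p ∧ p ≠ 2) :
    ∑ p ∈ P, w p ≤ W / (2 * selbergMass N) + M * (sigmaTotientSum N / selbergMass N) ^ 2 := by
  classical
  have hS := one_le_selbergMass hN
  have hfin : ∀ g : ℤ → ℝ, (∀ n : ℤ, w n = 0 → g n = 0) → Summable g := by
    intro g hg
    refine summable_of_ne_finset_zero (s := Finset.Icc ⌈a⌉ ⌊b⌋) fun n hn => hg n ?_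
    by_contra h
    obtain ⟨h1, h2⟩ := hsupp _ h
    exact hn (Finset.mem_Icc.mpr ⟨Int.ceil_le.mpr h1, Int.le_floor.mpr h2⟩)
  set lam := selbergWeight N with hlam
  set Z := oddSquarefree N with hZ
  -- The square of `T` majorizes the indicator of the primes above `N`: it is nonnegative
  -- everywhere, and at such a prime only `d = 1` contributes.
  let T : ℤ → ℝ := fun n => ∑ d ∈ Z, if (d : ℤ) ∣ n then lam d else 0
  let A : ℤ → ℝ := fun n => if Odd n then w n * T n ^ 2 else 0
  have hA0 : ∀ n, 0 ≤ A n := by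
    intro n
    simp only [A]
    split_ifs
    · exact mul_nonneg (hw _) (sq_nonneg _)
    · exact le_rfl
  have hAs : Summable A := hfin A fun n hn => by simp [A, hn]
  have h1 : ∑ p ∈ P, w p ≤ ∑' n, A n := by
    have hp : ∀ p ∈ P, w p = A ((p : ℕ) : ℤ) := by
      intro p hp
      obtain ⟨hpp, hpN, hp2⟩ := hP p hp
      have hodd : Odd ((p : ℕ) : ℤ) := by
        exact_mod_cast hpp.odd_of_ne_two hp2
      have hT : T p = 1 := by
        simp only [T]
        rw [Finset.sum_eq_single 1]
        · simp [hlam, selbergWeight_one hN]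
        · intro d hd hd1
          rw [if_neg]
          intro hdp
          have hdp' : d ∣ p := by exact_mod_cast hdp
          rcases (Nat.dvd_prime hpp).mp hdp' with h | h
          · exact hd1 h
          · have := (mem_oddSquarefree.mp hd).1.2
            omega
        · intro h
          exact absurd (one_mem_oddSquarefree hN) h
      simp only [A]
      rw [if_pos hodd, hT]
      simp
    rw [Finset.sum_congr rfl hp]
    have := hAs.sum_le_tsum (P.image fun p : ℕ => (p : ℤ)) (fun n _ => hA0 n)
    rwa [Finset.sum_image (by intro i _ j _ h; simpa using h)] at this
  let U : ℕ → ℤ → ℝ := fun D n => if Odd n ∧ (D : ℤ) ∣ n then w n else 0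
  have hUs : ∀ D, Summable (U D) := fun D => hfin _ fun n hn => by simp [U, hn]
  have hAU : ∀ n, A n = ∑ d ∈ Z, ∑ e ∈ Z, lam d * lam e * U (Nat.lcm d e) n := by
    intro n
    simp only [A, T]
    split_ifs with hodd
    · rw [sq, Finset.sum_mul_sum, Finset.mul_sum]
      refine Finset.sum_congr rfl fun d _ => ?_
      rw [Finset.mul_sum]
      refine Finset.sum_congr rfl fun e _ => ?_
      have hl : ((Nat.lcm d e : ℕ) : ℤ) ∣ n ↔ (d : ℤ) ∣ n ∧ (e : ℤ) ∣ n := by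
        simp only [Int.natCast_dvd]
        exact Nat.lcm_dvd_iff
      simp only [U, hl, hodd, true_and]
      by_cases h1 : (d : ℤ) ∣ n <;> by_cases h2 : (e : ℤ) ∣ n <;> simp [h1, h2]
      ring
    · simp [U, hodd]
  -- For odd `D`, the odd integers divisible by `D` are exactly the `D (2k + 1)`.
  have hUt : ∀ D : ℕ, 0 < D → D % 2 = 1 →
      ∑' n, U D n = ∑' k : ℤ, w (((D * (2 * k + 1) : ℤ)) : ℝ) := by
    intro D hD hD2
    have hinj : Function.Injective fun k : ℤ => (D : ℤ) * (2 * k + 1) := by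
      intro k l h
      have hD' : (D : ℤ) ≠ 0 := by exact_mod_cast hD.ne'
      have := mul_left_cancel₀ hD' h
      omega
    rw [← hinj.tsum_eq]
    · refine tsum_congr fun k => ?_
      have hodd : Odd ((D : ℤ) * (2 * k + 1)) :=
        (by exact_mod_cast Nat.odd_iff.mpr hD2 : Odd (D : ℤ)).mul ⟨k, rfl⟩
      simp only [U]
      rw [if_pos ⟨hodd, Dvd.intro _ rfl⟩]
    · intro n hn
      rw [Function.mem_support] at hn
      have hc : Odd n ∧ (D : ℤ) ∣ n := by
        by_contra h
        exact hn (by simp only [U]; rw [if_neg h])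
      obtain ⟨ho, m, rfl⟩ := hc
      obtain ⟨k, rfl⟩ := (Int.odd_mul.mp ho).2
      exact ⟨k, rfl⟩
  have h2 : ∑' n, A n = ∑ d ∈ Z, ∑ e ∈ Z, lam d * lam e * ∑' n, U (Nat.lcm d e) n := by
    rw [tsum_congr hAU, Summable.tsum_finsetSum]
    · refine Finset.sum_congr rfl fun d _ => ?_
      rw [Summable.tsum_finsetSum]
      · exact Finset.sum_congr rfl fun e _ => tsum_mul_left
      · exact fun e _ => (hUs _).mul_left _
    · exact fun d _ => summable_sum fun e _ => (hUs _).mul_left _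
  have h3 : ∀ d ∈ Z, ∀ e ∈ Z, lam d * lam e * ∑' n, U (Nat.lcm d e) n ≤
      W / 2 * (lam d * lam e * (1 / (Nat.lcm d e : ℝ))) + M * (|lam d| * |lam e|) := by
    intro d hd e he
    have hd' := mem_oddSquarefree.mp hd
    have he' := mem_oddSquarefree.mp he
    have hpos := Nat.lcm_pos hd'.1.1 he'.1.1
    have hodd : Nat.lcm d e % 2 = 1 := by
      have : Odd (d * e) := (Nat.odd_iff.mpr hd'.2.1).mul (Nat.odd_iff.mpr he'.2.1)
      exact Nat.odd_iff.mp (this.of_dvd_nat (Nat.lcm_dvd_mul d e))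
    rw [hUt _ hpos hodd]
    have hq := hdisc _ hpos
    set X := ∑' k : ℤ, w (((Nat.lcm d e * (2 * k + 1) : ℤ)) : ℝ)
    set L := W / 2 * (1 / (Nat.lcm d e : ℝ)) with hL
    have : lam d * lam e * (X - L) ≤ M * (|lam d| * |lam e|) := by
      calc lam d * lam e * (X - L) ≤ |lam d * lam e * (X - L)| := le_abs_self _
        _ = |lam d| * |lam e| * |X - L| := by rw [abs_mul, abs_mul]
        _ ≤ |lam d| * |lam e| * M := by gcongr
        _ = _ := by ring
    have e1 : W / 2 * (lam d * lam e * (1 / (Nat.lcm d e : ℝ))) = lam d * lam e * L := by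
      rw [hL]; ring
    rw [e1]
    linarith
  have hM : 0 ≤ M := (abs_nonneg _).trans (hdisc 1 one_pos)
  calc ∑ p ∈ P, w p ≤ ∑ d ∈ Z, ∑ e ∈ Z, lam d * lam e * ∑' n, U (Nat.lcm d e) n := h1.trans_eq h2
    _ ≤ ∑ d ∈ Z, ∑ e ∈ Z, (W / 2 * (lam d * lam e * (1 / (Nat.lcm d e : ℝ)))
        + M * (|lam d| * |lam e|)) :=
      Finset.sum_le_sum fun d hd => Finset.sum_le_sum fun e he => h3 d hd e he
    _ = W / 2 * (1 / selbergMass N) + M * (∑ d ∈ Z, |lam d|) ^ 2 := by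
      simp_rw [Finset.sum_add_distrib, ← Finset.mul_sum]
      rw [sum_sum_selbergWeight_mul_div_lcm hN, ← Finset.sum_mul]
      ring
    _ ≤ W / 2 * (1 / selbergMass N) + M * (sigmaTotientSum N / selbergMass N) ^ 2 := by
      gcongr
      exact sum_abs_selbergWeight_le hN
    _ = _ := by
      congr 1
      field_simp

/-! ### Lower bound for the sum of `1 / φ(k)` -/

/-- The reciprocals of integers with the same prime factors as a squarefree `k`
sum up to at most `1 / φ(k)`. -/
theorem sum_one_div_le_one_div_totient {k : ℕ} (hk : Squarefree k) (R : Finset ℕ)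
    (hR : ∀ n ∈ R, n ≠ 0 ∧ n.primeFactors = k.primeFactors) :
    ∑ n ∈ R, 1 / (n : ℝ) ≤ 1 / (k.totient : ℝ) := by
  classical
  have hk0 : (0 : ℝ) < k := by exact_mod_cast Nat.pos_of_ne_zero hk.ne_zero
  have hdvd : ∀ n ∈ R, k ∣ n := fun n hn => by
    rw [← Nat.prod_primeFactors_of_squarefree hk, ← (hR n hn).2]
    exact Nat.prod_primeFactors_dvd n
  let f : ℕ →* ℝ :=
    { toFun := fun m => (m : ℝ)⁻¹
      map_one' := by simp
      map_mul' := fun a b => by simp [mul_comm] }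
  obtain ⟨-, hs⟩ := EulerProduct.summable_and_hasSum_factoredNumbers_prod_filter_prime_geometric
    (f := f) (fun {p} hp => by
      change ‖(p : ℝ)⁻¹‖ < 1
      rw [norm_inv, Real.norm_natCast]
      exact inv_lt_one_of_one_lt₀ (by exact_mod_cast hp.one_lt)) k.primeFactors
  have hmem : ∀ n ∈ R, n / k ∈ Nat.factoredNumbers k.primeFactors := by
    intro n hn
    obtain ⟨h0, hpf⟩ := hR n hn
    refine Nat.mem_factoredNumbers_of_dvd
      (Nat.mem_factoredNumbers_of_primeFactors_subset h0 hpf.subset) (Nat.div_dvd_of_dvd (hdvd n hn))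
  have hfilter : (k.primeFactors.filter Nat.Prime) = k.primeFactors :=
    Finset.filter_true_of_mem fun p hp => Nat.prime_of_mem_primeFactors hp
  have hprod : (∏ p ∈ k.primeFactors, (1 - f p)⁻¹) = k / k.totient := by
    have h1 : (k.totient : ℝ) = k * ∏ p ∈ k.primeFactors, (1 - (p : ℝ)⁻¹) := by
      have := Nat.totient_eq_mul_prod_factors k
      have := congrArg (fun q : ℚ => (q : ℝ)) this
      push_cast at this
      exact this
    rw [Finset.prod_inv_distrib]
    change (∏ p ∈ k.primeFactors, (1 - (p : ℝ)⁻¹))⁻¹ = _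
    rw [h1]
    rw [div_mul_eq_div_div, div_self hk0.ne', one_div]
  rw [hfilter, hprod] at hs
  let ι : {n // n ∈ R} → Nat.factoredNumbers k.primeFactors := fun n => ⟨n / k, hmem n n.2⟩
  have hinj : Function.Injective ι := by
    intro a b h
    have h1 : (a : ℕ) / k = b / k := congrArg Subtype.val h
    have ha := Nat.div_mul_cancel (hdvd a a.2)
    have hb := Nat.div_mul_cancel (hdvd b b.2)
    exact Subtype.ext (by rw [← ha, ← hb, h1])
  have hle := sum_le_hasSum (R.attach.image ι) (fun i _ => by
    change 0 ≤ ((i : ℕ) : ℝ)⁻¹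
    positivity) hs
  rw [Finset.sum_image fun a _ b _ h => hinj h] at hle
  have hterm : ∑ n ∈ R, 1 / (n : ℝ) = (1 / k) * ∑ n ∈ R.attach, f (ι n) := by
    rw [Finset.mul_sum, ← Finset.sum_attach]
    refine Finset.sum_congr rfl fun n _ => ?_
    change 1 / ((n : ℕ) : ℝ) = 1 / k * (((n : ℕ) / k : ℕ) : ℝ)⁻¹
    rw [Nat.cast_div (hdvd n n.2) hk0.ne']
    field_simp
  rw [hterm]
  calc (1 / (k : ℝ)) * ∑ n ∈ R.attach, f (ι n) ≤ 1 / k * (k / k.totient) := by gcongr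
    _ = _ := by field_simp

/-- Group the odd `n ≤ N` by radical, which is an odd squarefree integer not exceeding `N`. -/
theorem sum_odd_one_div_le_selbergMass (N : ℕ) :
    ∑ n ∈ (Finset.Icc 1 N).filter (fun n => n % 2 = 1), 1 / (n : ℝ) ≤ selbergMass N := by
  classical
  have hmaps : ∀ n ∈ (Finset.Icc 1 N).filter (fun n => n % 2 = 1),
      ∏ p ∈ n.primeFactors, p ∈ oddSquarefree N := by
    intro n hn
    simp only [Finset.mem_filter, Finset.mem_Icc] at hn
    have hd := Nat.prod_primeFactors_dvd n
    rw [mem_oddSquarefree]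
    refine ⟨⟨Nat.pos_of_dvd_of_pos hd hn.1.1, (Nat.le_of_dvd hn.1.1 hd).trans hn.1.2⟩,
      Nat.odd_iff.mp ((Nat.odd_iff.mpr hn.2).of_dvd_nat hd), ?_⟩
    refine Finset.squarefree_prod_of_pairwise_isCoprime ?_
      fun p hp => (Nat.prime_of_mem_primeFactors hp).squarefree
    intro p hp q hq hpq
    exact Nat.coprime_iff_isRelPrime.mp ((Nat.coprime_primes (Nat.prime_of_mem_primeFactors hp)
      (Nat.prime_of_mem_primeFactors hq)).mpr hpq)
  rw [← Finset.sum_fiberwise_of_maps_to hmaps, selbergMass]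
  refine Finset.sum_le_sum fun k hk => ?_
  refine sum_one_div_le_one_div_totient (mem_oddSquarefree.mp hk).2.2 _ fun n hn => ?_
  simp only [Finset.mem_filter, Finset.mem_Icc] at hn
  refine ⟨by omega, ?_⟩
  rw [← hn.2, Nat.primeFactors_prod_primeFactors]

/-- The constant `1/4` lies just below the limiting value `γ/2`. In the induction the sum gains
`1/(2j+1)`, while half the logarithm gains at most that by `log(1 + v) ≤ v`. -/
theorem half_log_le_sum_odd {j : ℕ} (hj : 8 ≤ j) :
    1 / 2 * Real.log (2 * (2 * j + 1)) + 1 / 4 ≤ ∑ i ∈ Finset.range j, 1 / (2 * (i : ℝ) + 1) := by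
  induction j, hj using Nat.le_induction with
  | base =>
    have h1 : Real.log (2 * (2 * ((8 : ℕ) : ℝ) + 1)) ≤ 5 * Real.log 2 + 1 / 16 := by
      have : (2 * (2 * ((8 : ℕ) : ℝ) + 1)) = 2 ^ 5 * (1 + 1 / 16) := by norm_num
      rw [this, Real.log_mul (by norm_num) (by norm_num), Real.log_pow]
      have := Real.log_le_sub_one_of_pos (show (0 : ℝ) < 1 + 1 / 16 by norm_num)
      push_cast
      linarith
    have h2 := Real.log_two_lt_d9
    simp only [Finset.sum_range_succ, Finset.sum_range_zero]
    norm_num at h1 ⊢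
    linarith
  | succ j hj ih =>
    rw [Finset.sum_range_succ]
    have hpos : (0 : ℝ) < 2 * j + 1 := by positivity
    have h1 : Real.log (2 * (2 * ((j + 1 : ℕ) : ℝ) + 1)) ≤
        Real.log (2 * (2 * j + 1)) + 2 / (2 * j + 1) := by
      have : (2 * (2 * ((j + 1 : ℕ) : ℝ) + 1)) = 2 * (2 * j + 1) * (1 + 2 / (2 * j + 1)) := by
        push_cast
        field_simp
        ring
      rw [this, Real.log_mul (by positivity) (by positivity)]
      have := Real.log_le_sub_one_of_pos (show (0 : ℝ) < 1 + 2 / (2 * j + 1) by positivity)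
      linarith
    have h2 : 1 / (2 * (j : ℝ) + 1) = 1 / 2 * (2 / (2 * j + 1)) := by ring
    rw [h2]
    linarith

theorem half_log_le_selbergMass {N : ℕ} (hN : 15 ≤ N) :
    1 / 2 * Real.log (2 * (N + 1)) + 1 / 4 ≤ selbergMass N := by
  refine le_trans ?_ (sum_odd_one_div_le_selbergMass N)
  have h := half_log_le_sum_odd (j := (N + 1) / 2) (by omega)
  have h1 : Real.log (2 * ((N : ℝ) + 1)) ≤ Real.log (2 * (2 * ((N + 1) / 2 : ℕ) + 1)) := by
    apply Real.log_le_log (by positivity)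
    have : N + 1 ≤ 2 * ((N + 1) / 2) + 1 := by omega
    have : ((N + 1 : ℕ) : ℝ) ≤ ((2 * ((N + 1) / 2) + 1 : ℕ) : ℝ) := by exact_mod_cast this
    push_cast at this ⊢
    linarith
  have h2 : ∑ i ∈ Finset.range ((N + 1) / 2), 1 / (2 * (i : ℝ) + 1)
      ≤ ∑ n ∈ (Finset.Icc 1 N).filter (fun n => n % 2 = 1), 1 / (n : ℝ) := by
    have hs : (Finset.range ((N + 1) / 2)).image (fun i => 2 * i + 1)
        ⊆ (Finset.Icc 1 N).filter (fun n => n % 2 = 1) := by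
      intro n hn
      simp only [Finset.mem_image, Finset.mem_range, Finset.mem_filter, Finset.mem_Icc] at hn ⊢
      obtain ⟨i, hi, rfl⟩ := hn
      omega
    have := Finset.sum_le_sum_of_subset_of_nonneg (f := fun n : ℕ => 1 / (n : ℝ)) hs
      fun _ _ _ => by positivity
    rw [Finset.sum_image (by intro i _ j _ h; simpa using h)] at this
    push_cast at this
    exact this
  linarith

/-! ### Upper bound for the sum of `σ(k) / φ(k)` -/

theorem sum_divisors_div_totient {m : ℕ} (hm : Squarefree m) :
    ((∑ d ∈ m.divisors, d : ℕ) : ℝ) / (m.totient : ℝ)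
      = ∏ p ∈ m.primeFactors, (1 + 2 / ((p : ℝ) - 1)) := by
  have h1 : ∑ d ∈ m.divisors, d = ∏ p ∈ m.primeFactors, (1 + p) := by
    have := isMultiplicative_id.prodPrimeFactors_one_add_of_squarefree hm
    simpa using this.symm
  have h2 : m.totient = ∏ p ∈ m.primeFactors, (p - 1) := by
    have := Nat.totient_mul_prod_primeFactors m
    rw [Nat.prod_primeFactors_of_squarefree hm, mul_comm] at this
    exact Nat.eq_of_mul_eq_mul_left (Nat.pos_of_ne_zero hm.ne_zero) this
  rw [h1, h2]
  push_cast
  rw [← Finset.prod_div_distrib]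
  refine Finset.prod_congr rfl fun p hp => ?_
  have hp' := Nat.prime_of_mem_primeFactors hp
  have hp1 : (1 : ℝ) < p := by exact_mod_cast hp'.one_lt
  rw [Nat.cast_sub hp'.one_lt.le, Nat.cast_one]
  have : (p : ℝ) - 1 ≠ 0 := by linarith
  field_simp
  ring

/-- The odd positive integers up to `t`, weighted by the product of `1 + 2 / (p - 1)`
over their prime divisors `p` in `P`. -/
noncomputable def weightedOddCount (P : Finset ℕ) (t : ℝ) : ℝ :=
  ∑ m ∈ (Finset.Icc 1 ⌊t⌋₊).filter (fun m => m % 2 = 1),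
    ∏ p ∈ P, if p ∣ m then 1 + 2 / ((p : ℝ) - 1) else 1

theorem card_odd_Icc (n : ℕ) :
    ((Finset.Icc 1 n).filter (fun m => m % 2 = 1)).card = (n + 1) / 2 := by
  induction n with
  | zero => rfl
  | succ n ih =>
    rw [← Finset.insert_Icc_right_eq_Icc_add_one (by omega), Finset.filter_insert]
    split_ifs with h
    · rw [Finset.card_insert_of_notMem (by simp), ih]
      omega
    · rw [ih]
      omega

/-- Adding a prime `q` adds at most `2/(q-1)` times the same count at `t/q`, so a bound `X t/2 + Y
√t/2` keeps its shape. The error is taken as `√t` because a constant error would bring in the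
factors `1 + 2/(q-1)`, whose product over primes diverges. -/
theorem weightedOddCount_le (P : Finset ℕ) (hP : ∀ p ∈ P, p.Prime) {t : ℝ} (ht : 0 ≤ t) :
    weightedOddCount P t ≤ t / 2 * ∏ p ∈ P, (1 + 2 / ((p : ℝ) * (p - 1)))
      + √t / 2 * ∏ p ∈ P, (1 + 2 / (((p : ℝ) - 1) * √p)) := by
  classical
  induction P using Finset.induction_on generalizing t with
  | empty =>
    simp only [weightedOddCount, Finset.prod_empty, Finset.sum_const, nsmul_eq_mul, mul_one,
      card_odd_Icc]
    -- There are at most `t/2 + 1/2` odd integers up to `t`, and none if `t < 1`; otherwise `1 ≤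
    -- √t`.
    rcases lt_or_ge t 1 with h | h
    · rw [Nat.floor_eq_zero.mpr h]
      simp only [zero_add, Nat.reduceDiv, Nat.cast_zero]
      positivity
    · have h1 : (((⌊t⌋₊ + 1) / 2 : ℕ) : ℝ) ≤ ((⌊t⌋₊ + 1 : ℕ) : ℝ) / 2 := by
        exact_mod_cast Nat.cast_div_le (m := ⌊t⌋₊ + 1) (n := 2) (α := ℝ)
      have h2 := Nat.floor_le ht
      have h3 : 1 ≤ √t := Real.one_le_sqrt.mpr h
      push_cast at h1
      linarith
  | insert q P hq ih =>
    have hqp : q.Prime := hP q (Finset.mem_insert_self q P)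
    have hP' : ∀ p ∈ P, p.Prime := fun p hp => hP p (Finset.mem_insert_of_mem hp)
    have hq1 : (1 : ℝ) < q := by exact_mod_cast hqp.one_lt
    have hq0 : (0 : ℝ) < q := by linarith
    have hqs : (0 : ℝ) < (q : ℝ) - 1 := by linarith
    set g : ℕ → ℝ := fun m => ∏ p ∈ P, if p ∣ m then 1 + 2 / ((p : ℝ) - 1) else 1 with hg
    have hg0 : ∀ m, 0 ≤ g m := fun m => Finset.prod_nonneg fun p hp => by
      have : (1 : ℝ) < p := by exact_mod_cast (hP' p hp).one_lt
      have : (0 : ℝ) < (p : ℝ) - 1 := by linarith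
      split_ifs <;> positivity
    have hsplit : weightedOddCount (insert q P) t = weightedOddCount P t
        + 2 / ((q : ℝ) - 1) *
          ∑ m ∈ ((Finset.Icc 1 ⌊t⌋₊).filter (fun m => m % 2 = 1)).filter (q ∣ ·), g m := by
      rw [Finset.sum_filter, Finset.mul_sum, weightedOddCount, weightedOddCount,
        ← Finset.sum_add_distrib]
      refine Finset.sum_congr rfl fun m _ => ?_
      rw [Finset.prod_insert hq]
      change _ * g m = g m + _
      split_ifs <;> ring
    have hmul : ∑ m ∈ ((Finset.Icc 1 ⌊t⌋₊).filter (fun m => m % 2 = 1)).filter (q ∣ ·), g m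
        ≤ weightedOddCount P (t / q) := by
      have hsub : ((Finset.Icc 1 ⌊t⌋₊).filter (fun m => m % 2 = 1)).filter (q ∣ ·) ⊆
          ((Finset.Icc 1 ⌊t / q⌋₊).filter (fun m => m % 2 = 1)).image (q * ·) := by
        intro m hm
        simp only [Finset.mem_filter, Finset.mem_Icc, Finset.mem_image] at hm ⊢
        obtain ⟨⟨⟨h1, h2⟩, h3⟩, ⟨r, rfl⟩⟩ := hm
        refine ⟨r, ⟨⟨Nat.pos_of_ne_zero (by rintro rfl; simp at h1), ?_⟩, ?_⟩, rfl⟩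
        · apply Nat.le_floor
          rw [le_div_iff₀ hq0]
          have := (Nat.le_floor_iff ht).mp h2
          push_cast at this
          linarith
        · exact Nat.odd_iff.mp (Nat.odd_mul.mp (Nat.odd_iff.mpr h3)).2
      refine (Finset.sum_le_sum_of_subset_of_nonneg hsub fun m _ _ => hg0 m).trans ?_
      rw [Finset.sum_image fun a _ b _ h => Nat.eq_of_mul_eq_mul_left hqp.pos h]
      refine le_of_eq (Finset.sum_congr rfl fun r _ => Finset.prod_congr rfl fun p hp => ?_)
      have : p ∣ q * r ↔ p ∣ r := by
        rw [(hP' p hp).dvd_mul]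
        constructor
        · rintro (h | h)
          · rw [(Nat.prime_dvd_prime_iff_eq (hP' p hp) hqp).mp h] at hp
            exact absurd hp hq
          · exact h
        · exact Or.inr
      simp [this]
    have ih1 := ih hP' ht
    have ih2 := ih hP' (t := t / q) (by positivity)
    rw [hsplit, Finset.prod_insert hq, Finset.prod_insert hq]
    set X := ∏ p ∈ P, (1 + 2 / ((p : ℝ) * (p - 1)))
    set Y := ∏ p ∈ P, (1 + 2 / (((p : ℝ) - 1) * √p))
    rw [Real.sqrt_div ht] at ih2
    have hsq : (0 : ℝ) < √q := Real.sqrt_pos.mpr hq0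
    calc _ ≤ (t / 2 * X + √t / 2 * Y)
          + 2 / ((q : ℝ) - 1) * (t / q / 2 * X + √t / √q / 2 * Y) := by
          gcongr
          exact hmul.trans ih2
      _ = _ := by
        field_simp
        ring

/-- Sums over finite sets of odd integers `j ≥ k` of a function dominated by
`u j - u (j + 2)`. -/
theorem sum_odd_le_of_le_telescope {h u : ℕ → ℝ} {k : ℕ} (P : Finset ℕ)
    (hP : ∀ j ∈ P, k ≤ j ∧ j % 2 = k % 2) (h0 : ∀ j, k ≤ j → 0 ≤ h j) (hu : ∀ j, k ≤ j → 0 ≤ u j)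
    (hle : ∀ j, k ≤ j → h j ≤ u j - u (j + 2)) : ∑ j ∈ P, h j ≤ u k := by
  classical
  have hsub : P ⊆ (Finset.range (P.sup id + 1)).image fun i => k + 2 * i := by
    intro j hj
    obtain ⟨h1, h2⟩ := hP j hj
    have h3 : j ≤ P.sup id := Finset.le_sup (f := id) hj
    rw [Finset.mem_image]
    exact ⟨(j - k) / 2, by rw [Finset.mem_range]; omega, by omega⟩
  calc ∑ j ∈ P, h j ≤ ∑ j ∈ (Finset.range (P.sup id + 1)).image fun i => k + 2 * i, h j := by
        refine Finset.sum_le_sum_of_subset_of_nonneg hsub fun j hj _ => ?_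
        obtain ⟨i, -, rfl⟩ := Finset.mem_image.mp hj
        exact h0 _ (by omega)
    _ = ∑ i ∈ Finset.range (P.sup id + 1), h (k + 2 * i) :=
        Finset.sum_image (by intro i _ j _ h; simpa using h)
    _ ≤ ∑ i ∈ Finset.range (P.sup id + 1), (u (k + 2 * i) - u (k + 2 * (i + 1))) :=
        Finset.sum_le_sum fun i _ => hle _ (by omega)
    _ = u (k + 2 * 0) - u (k + 2 * (P.sup id + 1)) :=
        Finset.sum_range_sub' (fun i => u (k + 2 * i)) _
    _ ≤ u k := by
        have := hu (k + 2 * (P.sup id + 1)) (by omega)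
        simp only [mul_zero, add_zero]
        linarith

/-- The primes 3, 5, 7 are kept exactly. From 11 on, primes are replaced by all odd integers and the
product by the exponential of a telescoping sum. -/
theorem prod_one_add_odd_primes_le {h u : ℕ → ℝ} (P : Finset ℕ)
    (hP : ∀ p ∈ P, p.Prime ∧ p ≠ 2) (h0 : ∀ j, 3 ≤ j → 0 ≤ h j) (hu : ∀ j, 11 ≤ j → 0 ≤ u j)
    (hle : ∀ j, 11 ≤ j → h j ≤ u j - u (j + 2)) :
    ∏ p ∈ P, (1 + h p) ≤ (1 + h 3) * (1 + h 5) * (1 + h 7) * Real.exp (u 11) := by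
  classical
  have h3 : ∀ p ∈ P, 3 ≤ p := fun p hp => by
    have := (hP p hp).1.two_le
    have := (hP p hp).2
    omega
  rw [← Finset.prod_filter_mul_prod_filter_not P (fun p => p < 11)]
  have hsmall : ∏ p ∈ P with p < 11, (1 + h p) ≤ (1 + h 3) * (1 + h 5) * (1 + h 7) := by
    have hsub : (P.filter fun p => p < 11) ⊆ ({3, 5, 7} : Finset ℕ) := by
      intro p hp
      obtain ⟨hp1, hp2⟩ := Finset.mem_filter.mp hp
      have hpp := (hP p hp1).1
      have := h3 p hp1
      interval_cases p <;> first | decide | (exfalso; revert hpp; norm_num)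
    calc ∏ p ∈ P with p < 11, (1 + h p) ≤ ∏ p ∈ ({3, 5, 7} : Finset ℕ), (1 + h p) := by
          refine Finset.prod_le_prod_of_subset_of_one_le hsub ?_ ?_
          · intro p hp
            have := h0 p (h3 p (Finset.mem_filter.mp hp).1)
            linarith
          · intro p hp _
            have h3p : 3 ≤ p := by
              simp only [Finset.mem_insert, Finset.mem_singleton] at hp
              omega
            have := h0 p h3p
            linarith
      _ = _ := by
        simp [mul_assoc]
  have hlarge : ∏ p ∈ P with ¬ p < 11, (1 + h p) ≤ Real.exp (u 11) := by
    calc ∏ p ∈ P with ¬ p < 11, (1 + h p) ≤ ∏ p ∈ P with ¬ p < 11, Real.exp (h p) := by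
          refine Finset.prod_le_prod (fun p hp => ?_) fun p _ => ?_
          · have := h0 p (h3 p (Finset.mem_filter.mp hp).1)
            linarith
          · have := Real.add_one_le_exp (h p)
            linarith
      _ = Real.exp (∑ p ∈ P with ¬ p < 11, h p) := (Real.exp_sum _ _).symm
      _ ≤ Real.exp (u 11) := by
        rw [Real.exp_le_exp]
        refine sum_odd_le_of_le_telescope _ (fun p hp => ?_) (fun j hj => h0 j (by omega)) hu hle
        obtain ⟨hp1, hp2⟩ := Finset.mem_filter.mp hp
        have := Nat.odd_iff.mp ((hP p hp1).1.odd_of_ne_two (hP p hp1).2)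
        omega
  have := h0 3 le_rfl
  have := h0 5 (by norm_num)
  have := h0 7 (by norm_num)
  refine mul_le_mul hsmall hlarge (Finset.prod_nonneg fun p hp => ?_) (by positivity)
  have := h0 p (h3 p (Finset.mem_filter.mp hp).1)
  linarith

theorem sigmaTotientSum_le_weightedOddCount (N : ℕ) :
    sigmaTotientSum N ≤
      weightedOddCount ((Finset.Icc 1 N).filter fun p => p.Prime ∧ p ≠ 2) N := by
  classical
  rw [sigmaTotientSum, weightedOddCount, Nat.floor_natCast]
  have hterm : ∀ m ∈ oddSquarefree N, ((∑ d ∈ m.divisors, d : ℕ) : ℝ) / (m.totient : ℝ)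
      = ∏ p ∈ (Finset.Icc 1 N).filter (fun p => p.Prime ∧ p ≠ 2),
        if p ∣ m then 1 + 2 / ((p : ℝ) - 1) else 1 := by
    intro m hm
    obtain ⟨⟨h1, h2⟩, h3, h4⟩ := mem_oddSquarefree.mp hm
    rw [sum_divisors_div_totient h4, ← Finset.prod_filter]
    refine Finset.prod_congr ?_ fun _ _ => rfl
    ext p
    simp only [Nat.mem_primeFactors, Finset.mem_filter, Finset.mem_Icc]
    constructor
    · rintro ⟨hp, hpm, -⟩
      refine ⟨⟨⟨hp.one_lt.le, (Nat.le_of_dvd h1 hpm).trans h2⟩, hp, ?_⟩, hpm⟩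
      rintro rfl
      omega
    · rintro ⟨⟨-, hp, -⟩, hpm⟩
      exact ⟨hp, hpm, by omega⟩
  rw [Finset.sum_congr rfl hterm]
  refine Finset.sum_le_sum_of_subset_of_nonneg ?_ fun m _ _ => Finset.prod_nonneg fun p hp => ?_
  · intro m hm
    obtain ⟨h1, h2, -⟩ := mem_oddSquarefree.mp hm
    simp [h1, h2]
  · have : (1 : ℝ) < p := by exact_mod_cast (Finset.mem_filter.mp hp).2.1.one_lt
    have : (0 : ℝ) < (p : ℝ) - 1 := by linarith
    split_ifs <;> positivity

/-- Dropping squarefreeness still leaves the coefficient `1.7174 / 2 < 1` on `N`. The other term,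
`2.12 √N`, fits in the remaining room once `√N ≥ 15.49`. -/
theorem sigmaTotientSum_le_of_large {N : ℕ} (hN : 240 ≤ N) : sigmaTotientSum N ≤ N := by
  set P := (Finset.Icc 1 N).filter fun p => p.Prime ∧ p ≠ 2 with hPdef
  have hP : ∀ p ∈ P, p.Prime ∧ p ≠ 2 := fun p hp => (Finset.mem_filter.mp hp).2
  have hmain := (sigmaTotientSum_le_weightedOddCount N).trans
    (weightedOddCount_le P (fun p hp => (hP p hp).1) (Nat.cast_nonneg N))
  have hX : ∏ p ∈ P, (1 + 2 / ((p : ℝ) * (p - 1))) ≤ 1.7174 := by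
    have h := prod_one_add_odd_primes_le (h := fun p => 2 / ((p : ℝ) * (p - 1)))
      (u := fun j => 1 / ((j : ℝ) - 2)) P hP ?_ ?_ ?_
    · refine h.trans ?_
      have he : Real.exp (1 / 9) ≤ 1.1176 := by
        have h1 := Real.exp_one_lt_d9
        have h2 : Real.exp (1 / 9) ^ 9 = Real.exp 1 := by
          rw [← Real.exp_nat_mul]; norm_num
        refine le_of_pow_le_pow_left₀ (n := 9) (by norm_num) (by norm_num) ?_
        rw [h2]
        norm_num at h1 ⊢
        linarith
      norm_num at he ⊢
      linarith
    · intro j hj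
      have : (3 : ℝ) ≤ j := by exact_mod_cast hj
      have : (0 : ℝ) < (j : ℝ) - 1 := by linarith
      positivity
    · intro j hj
      have : (11 : ℝ) ≤ j := by exact_mod_cast hj
      have : (0 : ℝ) < (j : ℝ) - 2 := by linarith
      positivity
    · intro j hj
      have : (11 : ℝ) ≤ j := by exact_mod_cast hj
      have h1 : (0 : ℝ) < (j : ℝ) - 1 := by linarith
      have h2 : (0 : ℝ) < (j : ℝ) - 2 := by linarith
      have h3 : (0 : ℝ) < j := by linarith
      push_cast
      -- The telescoping difference is `2 / (j (j - 2))`, slightly more than the term `2 / (j (j -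
      -- 1))`.
      have e1 : 1 / ((j : ℝ) - 2) - 1 / ((j : ℝ) + 2 - 2) = 2 / (j * (j - 2)) := by
        rw [add_sub_cancel_right]
        field_simp
        ring
      rw [e1]
      gcongr
      norm_num
  have hY : ∏ p ∈ P, (1 + 2 / (((p : ℝ) - 1) * √p)) ≤ 4.24 := by
    have h := prod_one_add_odd_primes_le (h := fun p => 2 / (((p : ℝ) - 1) * √p))
      (u := fun j => 2 / √((j : ℝ) - 2)) P hP ?_ ?_ ?_
    · refine h.trans ?_
      have he : Real.exp (2 / 3) ≤ 1.948 := by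
        have h1 := Real.exp_one_lt_d9
        have h2 : Real.exp (2 / 3) ^ 3 = Real.exp 1 ^ 2 := by
          rw [← Real.exp_nat_mul, ← Real.exp_nat_mul]; norm_num
        refine le_of_pow_le_pow_left₀ (n := 3) (by norm_num) (by norm_num) ?_
        rw [h2]
        calc Real.exp 1 ^ 2 ≤ 2.7182818286 ^ 2 := by gcongr
          _ ≤ 1.948 ^ 3 := by norm_num
      have h3 : (1.732 : ℝ) ≤ √3 := Real.le_sqrt_of_sq_le (by norm_num)
      have h5 : (2.236 : ℝ) ≤ √5 := Real.le_sqrt_of_sq_le (by norm_num)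
      have h7 : (2.645 : ℝ) ≤ √7 := Real.le_sqrt_of_sq_le (by norm_num)
      have h9 : √((11 : ℕ) - 2 : ℝ) = 3 := by
        rw [show ((11 : ℕ) - 2 : ℝ) = 3 ^ 2 by norm_num, Real.sqrt_sq (by norm_num)]
      rw [h9]
      push_cast
      calc (1 + 2 / ((3 - 1) * √3)) * (1 + 2 / ((5 - 1) * √5)) * (1 + 2 / ((7 - 1) * √7))
            * Real.exp (2 / 3)
          ≤ (1 + 2 / ((3 - 1) * 1.732)) * (1 + 2 / ((5 - 1) * 2.236)) *
            (1 + 2 / ((7 - 1) * 2.645)) * 1.948 := by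
            have : (0 : ℝ) < 3 - 1 := by norm_num
            have : (0 : ℝ) < 5 - 1 := by norm_num
            have : (0 : ℝ) < 7 - 1 := by norm_num
            gcongr
        _ ≤ 4.24 := by norm_num
    · intro j hj
      have : (3 : ℝ) ≤ j := by exact_mod_cast hj
      have : (0 : ℝ) < (j : ℝ) - 1 := by linarith
      positivity
    · intro j hj
      positivity
    · intro j hj
      have : (11 : ℝ) ≤ j := by exact_mod_cast hj
      have h1 : (0 : ℝ) < (j : ℝ) - 1 := by linarith
      have h2 : (0 : ℝ) < (j : ℝ) - 2 := by linarith
      have h3 : (0 : ℝ) < j := by linarith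
      push_cast
      rw [add_sub_cancel_right]
      set r := √(j : ℝ) with hr
      set s := √((j : ℝ) - 2) with hs
      have hr0 : 0 < r := Real.sqrt_pos.mpr h3
      have hs0 : 0 < s := Real.sqrt_pos.mpr h2
      have hr2 : r ^ 2 = j := Real.sq_sqrt h3.le
      have hs2 : s ^ 2 = j - 2 := Real.sq_sqrt h2.le
      have hsr : s ≤ r := Real.sqrt_le_sqrt (by linarith)
      -- With `r = √j` and `s = √(j - 2)` the claim becomes polynomial, using `(r - s)(r + s) = 2`.
      have hj1 : (j : ℝ) - 1 = (r ^ 2 + s ^ 2) / 2 := by rw [hr2, hs2]; ring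
      rw [hj1, div_sub_div _ _ hs0.ne' hr0.ne', div_le_div_iff₀ (by positivity) (by positivity)]
      have hd : (r - s) * (r + s) = 2 := by nlinarith
      have key : 2 * s ≤ (r - s) * (r ^ 2 + s ^ 2) := by
        have : (r - s) * (r ^ 2 + s ^ 2) - 2 * s = (r - s) * (r ^ 2 - r * s) := by
          rw [← hd]; ring
        have h5 : 0 ≤ (r - s) * (r ^ 2 - r * s) :=
          mul_nonneg (by linarith) (by nlinarith)
        linarith
      calc 2 * (s * r) = r * (2 * s) := by ring
        _ ≤ r * ((r - s) * (r ^ 2 + s ^ 2)) := by gcongr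
        _ = _ := by ring
  have hNr : (240 : ℝ) ≤ N := by exact_mod_cast hN
  have hs : 15.49 ≤ √(N : ℝ) := Real.le_sqrt_of_sq_le (by norm_num; linarith)
  have hsN : √(N : ℝ) * √N = N := Real.mul_self_sqrt (by linarith)
  have h1 : (N : ℝ) / 2 * ∏ p ∈ P, (1 + 2 / ((p : ℝ) * (p - 1))) ≤ N / 2 * 1.7174 := by gcongr
  have h2 : √(N : ℝ) / 2 * ∏ p ∈ P, (1 + 2 / (((p : ℝ) - 1) * √p)) ≤ √N / 2 * 4.24 := by gcongr
  nlinarith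

theorem sigmaTotientSum_mono {M N : ℕ} (h : M ≤ N) : sigmaTotientSum M ≤ sigmaTotientSum N := by
  refine Finset.sum_le_sum_of_subset_of_nonneg ?_ fun _ _ _ => by positivity
  intro m hm
  rw [mem_oddSquarefree] at hm ⊢
  exact ⟨⟨hm.1.1, hm.1.2.trans h⟩, hm.2⟩

theorem sigmaTotientSum_le_of_rat {N M : ℕ}
    (h : (∑ k ∈ oddSquarefree N, ((∑ d ∈ k.divisors, d : ℕ) : ℚ) / (k.totient : ℚ)) ≤ M) :
    sigmaTotientSum N ≤ M := by
  have := (Rat.cast_le (K := ℝ)).mpr h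
  push_cast at this
  simpa [sigmaTotientSum] using this

/-- By monotonicity a whole block `a ≤ N ≤ b` follows from the single check that the sum at `b` is
at most `a`; a few blocks cover 15 to 240. -/
theorem sigmaTotientSum_le {N : ℕ} (hN : 15 ≤ N) : sigmaTotientSum N ≤ N := by
  have step : ∀ {a b : ℕ}, a ≤ N → N ≤ b →
      (∑ k ∈ oddSquarefree b, ((∑ d ∈ k.divisors, d : ℕ) : ℚ) / (k.totient : ℚ)) ≤ a →
      sigmaTotientSum N ≤ N := by
    intro a b ha hb h
    exact ((sigmaTotientSum_mono hb).trans (sigmaTotientSum_le_of_rat h)).trans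
      (by exact_mod_cast ha)
  rcases le_or_gt N 20 with h | h
  · exact step hN h (by decide +kernel)
  rcases le_or_gt N 32 with h' | h'
  · exact step h.le h' (by decide +kernel)
  rcases le_or_gt N 50 with h | h
  · exact step h'.le h (by decide +kernel)
  rcases le_or_gt N 82 with h' | h'
  · exact step h.le h' (by decide +kernel)
  rcases le_or_gt N 130 with h | h
  · exact step h'.le h (by decide +kernel)
  rcases le_or_gt N 212 with h' | h'
  · exact step h.le h' (by decide +kernel)
  rcases le_or_gt N 240 with h | h
  · exact step h'.le h (by decide +kernel)
  · exact sigmaTotientSum_le_of_large h.le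

theorem selbergMass_eq_rat (N : ℕ) :
    selbergMass N = ((∑ k ∈ oddSquarefree N, 1 / (k.totient : ℚ) : ℚ) : ℝ) := by
  push_cast
  rfl

theorem sigmaTotientSum_eq_rat (N : ℕ) : sigmaTotientSum N =
    ((∑ k ∈ oddSquarefree N, ((∑ d ∈ k.divisors, d : ℕ) : ℚ) / (k.totient : ℚ) : ℚ) : ℝ) := by
  push_cast
  simp [sigmaTotientSum]

/-! ### Choice of the sieve level -/

/-- The choice of the level in Selberg's sieve for an interval of length `y`. -/
theorem exists_selberg_level {y : ℝ} (hy : 2 < y) : ∃ N : ℕ, 1 ≤ N ∧ ((N : ℝ) ≤ 7 ∨ (N : ℝ) ≤ √y) ∧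
    y / (2 * selbergMass N) + (sigmaTotientSum N / selbergMass N) ^ 2
      ≤ 2 * y / Real.log (y / 2) := by
  have hl0 : 0 < Real.log (y / 2) := Real.log_pos (by linarith)
  have hl2 := Real.log_two_lt_d9
  have hpow : ∀ n : ℕ, y / 2 ≤ 2 ^ n → Real.log (y / 2) ≤ n * Real.log 2 := by
    intro n hn
    have := Real.log_le_log (by linarith) hn
    rwa [Real.log_pow] at this
  -- Short intervals use the fixed levels 1 and 7 with exact rational values; beyond 1800 the choice
  -- `Q = √(y/8)` is at least 15, where the general bounds apply.
  rcases le_or_gt y 60 with h60 | h60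
  · refine ⟨1, le_rfl, Or.inl (by norm_num), ?_⟩
    have hS : selbergMass 1 = 1 := by
      rw [selbergMass_eq_rat, show (∑ k ∈ oddSquarefree 1, 1 / (k.totient : ℚ)) = 1 by
        decide +kernel]
      norm_num
    have hH : sigmaTotientSum 1 = 1 := by
      rw [sigmaTotientSum_eq_rat, show (∑ k ∈ oddSquarefree 1, ((∑ d ∈ k.divisors, d : ℕ) : ℚ)
        / (k.totient : ℚ)) = 1 by decide +kernel]
      norm_num
    rw [hS, hH, le_div_iff₀ hl0]
    rcases le_or_gt y 4 with h4 | h4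
    · have := hpow 1 (by norm_num; linarith)
      norm_num at this ⊢
      nlinarith
    rcases le_or_gt y 16 with h16 | h16
    · have := hpow 3 (by norm_num; linarith)
      norm_num at this ⊢
      nlinarith
    · have := hpow 5 (by norm_num; linarith)
      norm_num at this ⊢
      nlinarith
  rcases le_or_gt y 1800 with h1800 | h1800
  · refine ⟨7, by norm_num, Or.inl (by norm_num), ?_⟩
    have hS : selbergMass 7 = 23 / 12 := by
      rw [selbergMass_eq_rat, show (∑ k ∈ oddSquarefree 7, 1 / (k.totient : ℚ)) = 23 / 12 by
        decide +kernel]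
      norm_num
    have hH : sigmaTotientSum 7 = 35 / 6 := by
      rw [sigmaTotientSum_eq_rat, show (∑ k ∈ oddSquarefree 7, ((∑ d ∈ k.divisors, d : ℕ) : ℚ)
        / (k.totient : ℚ)) = 35 / 6 by decide +kernel]
      norm_num
    rw [hS, hH, le_div_iff₀ hl0]
    norm_num
    have hc : ∀ K : ℝ, Real.log (y / 2) ≤ K → (y / (23 / 6) + 4900 / 529) * K ≤ 2 * y →
        (y / (23 / 6) + 4900 / 529) * Real.log (y / 2) ≤ 2 * y := by
      intro K hK h
      refine le_trans ?_ h
      gcongr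
    rcases le_or_gt y 128 with h4 | h4
    · have := hpow 6 (by norm_num; linarith)
      refine hc 4.2 (by norm_num at this ⊢; linarith) (by linarith)
    rcases le_or_gt y 512 with h16 | h16
    · have := hpow 8 (by norm_num; linarith)
      refine hc 5.6 (by norm_num at this ⊢; linarith) (by linarith)
    · have := hpow 10 (by norm_num; linarith)
      refine hc 6.94 (by norm_num at this ⊢; linarith) (by linarith)
  · set Q := √(y / 8) with hQ
    have hQ15 : 15 ≤ Q := Real.le_sqrt_of_sq_le (by norm_num; linarith)
    have hQ2 : Q ^ 2 = y / 8 := Real.sq_sqrt (by linarith)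
    have hN15 : 15 ≤ ⌊Q⌋₊ := Nat.le_floor (by exact_mod_cast hQ15)
    have hNQ : (⌊Q⌋₊ : ℝ) ≤ Q := Nat.floor_le (by linarith)
    refine ⟨⌊Q⌋₊, by omega, Or.inr (hNQ.trans (Real.sqrt_le_sqrt (by linarith))), ?_⟩
    have hH : sigmaTotientSum ⌊Q⌋₊ ≤ Q := (sigmaTotientSum_le hN15).trans hNQ
    have hH0 : 0 ≤ sigmaTotientSum ⌊Q⌋₊ := Finset.sum_nonneg fun _ _ => by positivity
    -- `Q² = y/8` makes `2 log(2Q) = log(y/2) = l`. The two terms become `2y/(l+1)` and `2y/(l+1)²`,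
    -- and `l (l+2) ≤ (l+1)²` finishes.
    have hS : (Real.log (y / 2) + 1) / 4 ≤ selbergMass ⌊Q⌋₊ := by
      refine le_trans ?_ (half_log_le_selbergMass hN15)
      have h1 : Real.log (2 * Q) ≤ Real.log (2 * (⌊Q⌋₊ + 1)) := by
        apply Real.log_le_log (by linarith)
        have := Nat.lt_floor_add_one Q
        linarith
      have h2 : 2 * Real.log (2 * Q) = Real.log (y / 2) := by
        rw [show y / 2 = (2 * Q) ^ 2 by rw [mul_pow, hQ2]; ring, Real.log_pow]
        norm_num
      linarith
    set l := Real.log (y / 2) with hl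
    have hlpos : 0 < (l + 1) / 4 := by linarith
    have hratio : 0 ≤ sigmaTotientSum ⌊Q⌋₊ / selbergMass ⌊Q⌋₊ :=
      div_nonneg hH0 (hlpos.le.trans hS)
    calc y / (2 * selbergMass ⌊Q⌋₊) + (sigmaTotientSum ⌊Q⌋₊ / selbergMass ⌊Q⌋₊) ^ 2
        ≤ y / (2 * ((l + 1) / 4)) + (Q / ((l + 1) / 4)) ^ 2 := by gcongr
      _ = 2 * y * ((l + 2) / (l + 1) ^ 2) := by
        rw [div_pow, hQ2]
        field_simp
        ring
      _ ≤ 2 * y * (1 / l) := by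
        gcongr 2 * y * ?_
        rw [div_le_div_iff₀ (by positivity) hl0]
        nlinarith
      _ = 2 * y / l := by ring

end

section

/-! ### The Bessel function `I₀` and its Laplace transform -/

open Finset

theorem hasSum_besselI0 (t : ℝ) :
    HasSum (fun n : ℕ => (t / 2) ^ (2 * n) / ((n.factorial : ℝ) ^ 2)) (besselI0 t) := by
  refine Summable.hasSum ?_
  refine Summable.of_nonneg_of_le (fun n => by rw [pow_mul]; positivity) (fun n => ?_)
    (Real.summable_pow_div_factorial ((t / 2) ^ 2))
  rw [pow_mul]
  have h1 : (1 : ℝ) ≤ n.factorial := by exact_mod_cast Nat.one_le_iff_ne_zero.mpr n.factorial_ne_zero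
  gcongr
  nlinarith

theorem besselI0_nonneg (t : ℝ) : 0 ≤ besselI0 t :=
  (hasSum_besselI0 t).nonneg fun n => by rw [pow_mul]; positivity

theorem continuous_besselI0 : Continuous besselI0 := by
  rw [continuous_iff_continuousAt]
  intro t₀
  have hc : ContinuousOn besselI0 (Metric.ball 0 (|t₀| + 1)) := by
    refine continuousOn_tsum (u := fun n => ((|t₀| + 1) / 2) ^ (2 * n) / ((n.factorial : ℝ) ^ 2))
      (fun n => by fun_prop) (hasSum_besselI0 (|t₀| + 1)).summable ?_
    intro n t ht
    rw [Metric.mem_ball, dist_zero_right, Real.norm_eq_abs] at ht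
    rw [norm_div, norm_pow, norm_pow, Real.norm_natCast, norm_div, Real.norm_eq_abs,
      Real.norm_two]
    gcongr
  refine hc.continuousAt (Metric.isOpen_ball.mem_nhds ?_)
  rw [Metric.mem_ball, dist_zero_right, Real.norm_eq_abs]
  linarith

/-- A Beta integral at half-integer arguments. Multiplying by `1 - s²` raises `n` and splits the
integral into the cases `k` and `k + 1`, hence the induction on `n` with `k` free. -/
theorem integral_pow_mul_one_sub_sq_pow (n k : ℕ) :
    ∫ s in (-1 : ℝ)..1, s ^ (2 * k) * (1 - s ^ 2) ^ n =
      2 * ((2 * k).factorial : ℝ) * n.factorial * 4 ^ n * (n + k).factorial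
        / (k.factorial * (2 * (n + k) + 1).factorial) := by
  induction n generalizing k with
  | zero =>
    simp only [pow_zero, mul_one, integral_pow, Nat.factorial_zero, Nat.cast_one, zero_add]
    rw [Odd.neg_one_pow ⟨k, rfl⟩, Nat.factorial_succ (2 * k)]
    have h1 := (Nat.factorial_pos k).ne'
    have h2 := (Nat.factorial_pos (2 * k)).ne'
    push_cast
    field_simp
    norm_num
  | succ n ih =>
    have h : ∀ s : ℝ, s ^ (2 * k) * (1 - s ^ 2) ^ (n + 1)
        = s ^ (2 * k) * (1 - s ^ 2) ^ n - s ^ (2 * (k + 1)) * (1 - s ^ 2) ^ n := by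
      intro s
      ring
    simp_rw [h]
    rw [intervalIntegral.integral_sub (Continuous.intervalIntegrable (by fun_prop) _ _)
      (Continuous.intervalIntegrable (by fun_prop) _ _), ih, ih]
    have e1 : n + 1 + k = n + k + 1 := by ring
    have e2 : n + (k + 1) = n + k + 1 := by ring
    have e3 : 2 * (k + 1) = 2 * k + 1 + 1 := by ring
    have e4 : 2 * (n + k + 1) + 1 = 2 * (n + k) + 1 + 1 + 1 := by ring
    rw [e1, e2, e3, e4, Nat.factorial_succ (2 * (n + k) + 1 + 1),
      Nat.factorial_succ (2 * (n + k) + 1), Nat.factorial_succ (2 * k + 1),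
      Nat.factorial_succ (2 * k), Nat.factorial_succ n, Nat.factorial_succ k,
      Nat.factorial_succ (n + k)]
    have h1 := (Nat.factorial_pos k).ne'
    have h2 := (Nat.factorial_pos (2 * (n + k) + 1)).ne'
    have h3 : (0 : ℝ) < 2 * (n + k) + 1 + 1 := by positivity
    have h4 : (0 : ℝ) < 2 * (n + k) + 1 + 1 + 1 := by positivity
    push_cast
    field_simp
    ring

theorem hasSum_mul_of_nonneg {f g : ℕ → ℝ} {s t : ℝ} (hf : HasSum f s) (hg : HasSum g t)
    (hf0 : ∀ n, 0 ≤ f n) (hg0 : ∀ n, 0 ≤ g n) :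
    HasSum (fun q : ℕ × ℕ => f q.1 * g q.2) (s * t) :=
  hf.mul hg (Summable.mul_of_nonneg hf.summable hg.summable hf0 hg0)

theorem hasSum_sum_antidiagonal {f : ℕ × ℕ → ℝ} {a : ℝ} (hf : HasSum f a) :
    HasSum (fun N => ∑ q ∈ Finset.HasAntidiagonal.antidiagonal N, f q) a :=
  (Finset.HasAntidiagonal.sigmaAntidiagonalEquivProd (A := ℕ)).hasSum_iff.mpr hf |>.sigma
    fun N => (Finset.HasAntidiagonal.antidiagonal N).hasSum f

/-- The Laplace transform of `s ↦ I₀(c √(1 - s²))` on `[-1, 1]`. -/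
theorem integral_cosh_mul_besselI0 (a : ℝ) {c : ℝ} (hc : 0 < c) :
    ∫ s in (-1 : ℝ)..1, Real.cosh (a * s) * besselI0 (c * √(1 - s ^ 2)) =
      2 * (Real.sinh (√(a ^ 2 + c ^ 2)) / √(a ^ 2 + c ^ 2)) := by
  set r := √(a ^ 2 + c ^ 2) with hr
  have hr0 : 0 < r := Real.sqrt_pos.mpr (by positivity)
  have hr2 : r ^ 2 = a ^ 2 + c ^ 2 := Real.sq_sqrt (by positivity)
  -- Using `cosh` instead of `exp` makes every term of the double series nonnegative on `[-1, 1]`,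
  -- and dominated by `bd`.
  let F : ℕ × ℕ → ℝ → ℝ := fun q s =>
    (a * s) ^ (2 * q.1) / (2 * q.1).factorial *
      ((c / 2) ^ (2 * q.2) / ((q.2.factorial : ℝ) ^ 2) * (1 - s ^ 2) ^ q.2)
  let bd : ℕ × ℕ → ℝ := fun q =>
    a ^ (2 * q.1) / (2 * q.1).factorial * ((c / 2) ^ (2 * q.2) / ((q.2.factorial : ℝ) ^ 2))
  have hbd : Summable bd :=
    (hasSum_mul_of_nonneg (Real.hasSum_cosh a) (hasSum_besselI0 c)
      (fun n => by rw [pow_mul]; positivity) (fun n => by positivity)).summable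
  have hpt : ∀ s : ℝ, s ^ 2 ≤ 1 →
      HasSum (fun q => F q s) (Real.cosh (a * s) * besselI0 (c * √(1 - s ^ 2))) := by
    intro s hs
    have h1 := Real.hasSum_cosh (a * s)
    have h2 : HasSum (fun n : ℕ => (c / 2) ^ (2 * n) / ((n.factorial : ℝ) ^ 2) * (1 - s ^ 2) ^ n)
        (besselI0 (c * √(1 - s ^ 2))) := by
      convert hasSum_besselI0 (c * √(1 - s ^ 2)) using 2 with n
      have : (√(1 - s ^ 2)) ^ (2 * n) = (1 - s ^ 2) ^ n := by
        rw [pow_mul, Real.sq_sqrt (by linarith)]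
      rw [mul_div_right_comm, mul_pow, this]
      ring
    have h4 : 0 ≤ 1 - s ^ 2 := by linarith
    exact hasSum_mul_of_nonneg h1 h2 (fun n => by rw [pow_mul]; positivity)
      (fun n => by positivity)
  have hmem : ∀ s : ℝ, s ∈ Set.uIoc (-1 : ℝ) 1 → s ^ 2 ≤ 1 := by
    intro s hs
    rw [Set.uIoc_of_le (by norm_num)] at hs
    nlinarith [hs.1, hs.2]
  have hbound : ∀ q : ℕ × ℕ, ∀ s ∈ Set.uIoc (-1 : ℝ) 1, ‖F q s‖ ≤ bd q := by
    intro q s hs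
    have hs2 := hmem s hs
    have hs1 : |s| ≤ 1 := (sq_le_one_iff_abs_le_one s).mp hs2
    have h0 : 0 ≤ 1 - s ^ 2 := by linarith
    have h1 : (1 - s ^ 2) ^ q.2 ≤ 1 := pow_le_one₀ h0 (by nlinarith)
    have h2 : s ^ (2 * q.1) ≤ 1 := by
      rw [pow_mul]
      exact pow_le_one₀ (sq_nonneg s) hs2
    have h3 : 0 ≤ s ^ (2 * q.1) := by rw [pow_mul]; positivity
    have h4 : 0 ≤ bd q := by simp only [bd]; rw [pow_mul]; positivity
    have e : F q s = bd q * (s ^ (2 * q.1) * (1 - s ^ 2) ^ q.2) := by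
      simp only [F, bd]
      ring
    rw [e, Real.norm_eq_abs, abs_of_nonneg (by positivity)]
    calc bd q * (s ^ (2 * q.1) * (1 - s ^ 2) ^ q.2) ≤ bd q * (1 * 1) := by gcongr
      _ = bd q := by ring
  have hmeas : ∀ q, Continuous (F q) := fun q => by simp only [F]; fun_prop
  have hint : HasSum (fun q => ∫ s in (-1 : ℝ)..1, F q s)
      (∫ s in (-1 : ℝ)..1, Real.cosh (a * s) * besselI0 (c * √(1 - s ^ 2))) :=
    intervalIntegral.hasSum_integral_of_dominated_convergence (fun q _ => bd q)
      (fun q => (hmeas q).aestronglyMeasurable)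
      (fun q => Filter.Eventually.of_forall (hbound q))
      (Filter.Eventually.of_forall fun s _ => hbd) intervalIntegrable_const
      (Filter.Eventually.of_forall fun s hs => hpt s (hmem s hs))
  have hterm : ∀ q : ℕ × ℕ, ∫ s in (-1 : ℝ)..1, F q s =
      2 * ((q.1 + q.2).choose q.1 * ((a ^ 2) ^ q.1 * (c ^ 2) ^ q.2))
        / (2 * (q.1 + q.2) + 1).factorial := by
    rintro ⟨k, n⟩
    have : ∀ s, F (k, n) s = a ^ (2 * k) / (2 * k).factorial *
        ((c / 2) ^ (2 * n) / ((n.factorial : ℝ) ^ 2)) * (s ^ (2 * k) * (1 - s ^ 2) ^ n) := by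
      intro s
      simp only [F]
      ring
    simp_rw [this]
    rw [intervalIntegral.integral_const_mul, integral_pow_mul_one_sub_sq_pow,
      Nat.cast_add_choose, pow_mul a, pow_mul (c / 2), div_pow c, div_pow (c ^ 2), add_comm n k]
    have h1 := (Nat.factorial_pos k).ne'
    have h2 := (Nat.factorial_pos n).ne'
    have h3 := (Nat.factorial_pos (2 * k)).ne'
    have h4 := (Nat.factorial_pos (2 * (k + n) + 1)).ne'
    have h5 : ((2 : ℝ) ^ 2) ^ n = 4 ^ n := by norm_num
    rw [h5]
    field_simp
  simp_rw [hterm] at hint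
  have hN := hasSum_sum_antidiagonal hint
  -- Along `k + n = N` the Beta integrals reduce to binomial coefficients, so the binomial theorem
  -- produces `(a² + c²)^N`, the terms of `sinh r / r`.
  have hfin : ∀ N, ∑ q ∈ Finset.HasAntidiagonal.antidiagonal N,
      2 * (((q.1 + q.2).choose q.1 : ℝ) * ((a ^ 2) ^ q.1 * (c ^ 2) ^ q.2))
        / ((2 * (q.1 + q.2) + 1).factorial : ℝ)
      = 2 * (r ^ 2) ^ N / (2 * N + 1).factorial := by
    intro N
    have : ∀ q ∈ Finset.HasAntidiagonal.antidiagonal N,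
        2 * (((q.1 + q.2).choose q.1 : ℝ) * ((a ^ 2) ^ q.1 * (c ^ 2) ^ q.2))
          / ((2 * (q.1 + q.2) + 1).factorial : ℝ)
        = 2 / ((2 * N + 1).factorial : ℝ) * (N.choose q.1 • ((a ^ 2) ^ q.1 * (c ^ 2) ^ q.2)) := by
      intro q hq
      rw [Finset.HasAntidiagonal.mem_antidiagonal.mp hq, nsmul_eq_mul]
      ring
    rw [Finset.sum_congr rfl this, ← Finset.mul_sum, ← Commute.add_pow' (Commute.all _ _), hr2]
    ring
  simp_rw [hfin] at hN
  have hsinh := ((Real.hasSum_sinh r).mul_left (2 / r))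
  have : (fun n : ℕ => 2 / r * (r ^ (2 * n + 1) / ((2 * n + 1).factorial : ℝ)))
      = fun N => 2 * (r ^ 2) ^ N / (2 * N + 1).factorial := by
    ext n
    rw [pow_succ, pow_mul]
    field_simp
  rw [this] at hsinh
  rw [hN.unique hsinh]
  ring

/-- The Bessel factor is even, so only the even part of the exponential contributes. -/
theorem integral_exp_mul_besselI0 (a : ℝ) {c : ℝ} (hc : 0 < c) :
    ∫ s in (-1 : ℝ)..1, Real.exp (a * s) * besselI0 (c * √(1 - s ^ 2)) =
      2 * (Real.sinh (√(a ^ 2 + c ^ 2)) / √(a ^ 2 + c ^ 2)) := by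
  have hcont : ∀ b : ℝ, Continuous fun s : ℝ => Real.exp (b * s) * besselI0 (c * √(1 - s ^ 2)) :=
    fun b => (by fun_prop : Continuous fun s : ℝ => Real.exp (b * s)).mul
      (continuous_besselI0.comp (by fun_prop))
  have hneg : ∫ s in (-1 : ℝ)..1, Real.exp (-a * s) * besselI0 (c * √(1 - s ^ 2))
      = ∫ s in (-1 : ℝ)..1, Real.exp (a * s) * besselI0 (c * √(1 - s ^ 2)) := by
    have := intervalIntegral.integral_comp_neg (a := -1) (b := 1)
      (fun s => Real.exp (a * s) * besselI0 (c * √(1 - s ^ 2)))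
    rw [neg_neg] at this
    rw [← this]
    refine intervalIntegral.integral_congr fun s _ => ?_
    simp only [neg_sq, neg_mul, mul_neg]
  rw [← integral_cosh_mul_besselI0 a hc]
  have : ∀ s : ℝ, Real.cosh (a * s) * besselI0 (c * √(1 - s ^ 2)) =
      1 / 2 * (Real.exp (a * s) * besselI0 (c * √(1 - s ^ 2))
        + Real.exp (-a * s) * besselI0 (c * √(1 - s ^ 2))) := by
    intro s
    rw [Real.cosh_eq, neg_mul]
    ring
  simp_rw [this]
  rw [intervalIntegral.integral_const_mul, intervalIntegral.integral_add
    ((hcont a).intervalIntegrable _ _) ((hcont (-a)).intervalIntegrable _ _), hneg]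
  ring

/-- At `i/2` the radicand is `-((ε/2)² + c²)`. Either square root is `± i r`, and the even function
`sin w / w` takes the value `sinh r / r` there. -/
theorem loganLambda_eq (c ε : ℝ) (hc : 0 < c) :
    loganLambda c ε = c / Real.sinh c *
      (Real.sinh (√((ε / 2) ^ 2 + c ^ 2)) / √((ε / 2) ^ 2 + c ^ 2)) := by
  set r := √((ε / 2) ^ 2 + c ^ 2) with hr
  have hr0 : 0 < r := Real.sqrt_pos.mpr (by positivity)
  have hr2 : r ^ 2 = (ε / 2) ^ 2 + c ^ 2 := Real.sq_sqrt (by positivity)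
  set w := ((Complex.I / 2 * ε) ^ 2 - (c : ℂ) ^ 2) ^ (1 / 2 : ℂ) with hw
  have hw2 : w ^ 2 = (Complex.I * r) ^ 2 := by
    have h1 : w ^ 2 = (Complex.I / 2 * ε) ^ 2 - (c : ℂ) ^ 2 := by
      rw [hw, one_div]
      exact Complex.cpow_nat_inv_pow _ two_ne_zero
    have h2 : (r : ℂ) ^ 2 = ((ε : ℂ) / 2) ^ 2 + (c : ℂ) ^ 2 := by
      exact_mod_cast congrArg Complex.ofReal hr2
    rw [h1, mul_pow Complex.I, h2, mul_pow, div_pow, Complex.I_sq]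
    ring
  have hr' : (r : ℂ) ≠ 0 := by exact_mod_cast hr0.ne'
  have hs : complexSinc w = ((Real.sinh r / r : ℝ) : ℂ) := by
    have hI : Complex.I * r ≠ 0 := mul_ne_zero Complex.I_ne_zero hr'
    have hsin : Complex.sin (Complex.I * r) = Complex.I * Complex.sinh r := by
      rw [mul_comm, Complex.sin_mul_I, mul_comm]
    rcases sq_eq_sq_iff_eq_or_eq_neg.mp hw2 with h | h
    · rw [h, complexSinc, if_neg hI, hsin]
      push_cast
      rw [mul_div_mul_left _ _ Complex.I_ne_zero]
    · rw [h, complexSinc, if_neg (neg_ne_zero.mpr hI), Complex.sin_neg, neg_div_neg_eq, hsin]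
      push_cast
      rw [mul_div_mul_left _ _ Complex.I_ne_zero]
  rw [loganLambda, logan, ← hw, hs]
  have : (c : ℂ) / Complex.sinh c * ((Real.sinh r / r : ℝ) : ℂ)
      = ((c / Real.sinh c * (Real.sinh r / r) : ℝ) : ℂ) := by push_cast; rfl
  rw [this, Complex.ofReal_re]

end

section

/-! ### Tails of `η`, the functions `μ` and `ν`, and the smoothed cutoff -/

open MeasureTheory Set

theorem chiStar_nonneg {X : Type*} [TopologicalSpace X] (A : Set X) (x : X) :
    0 ≤ chiStar A x := by
  rw [chiStar]
  split_ifs <;> norm_num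

theorem chiStar_le_one {X : Type*} [TopologicalSpace X] (A : Set X) (x : X) :
    chiStar A x ≤ 1 := by
  rw [chiStar]
  split_ifs <;> norm_num

theorem chiStar_Icc_of_mem_Ioo {a b t : ℝ} (h : t ∈ Ioo a b) : chiStar (Icc a b) t = 1 := by
  have hab : a ≤ b := (h.1.trans h.2).le
  rw [chiStar, frontier_Icc hab, if_neg, if_pos (Ioo_subset_Icc_self h)]
  simp only [mem_insert_iff, mem_singleton_iff, not_or]
  exact ⟨h.1.ne', h.2.ne⟩

theorem chiStar_Icc_of_notMem {a b t : ℝ} (hab : a ≤ b) (h : t ∉ Icc a b) :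
    chiStar (Icc a b) t = 0 := by
  rw [chiStar, frontier_Icc hab, if_neg, if_neg h]
  simp only [mem_insert_iff, mem_singleton_iff, not_or]
  exact ⟨fun e => h ⟨e.ge, e.le.trans hab⟩, fun e => h ⟨hab.trans e.ge, e.le⟩⟩

theorem chiStar_Icc_eq_of_iff {a b s a' b' s' : ℝ} (hab : a ≤ b) (hab' : a' ≤ b')
    (h1 : s = a ↔ s' = a') (h2 : s = b ↔ s' = b') (h3 : s ∈ Icc a b ↔ s' ∈ Icc a' b') :
    chiStar (Icc a b) s = chiStar (Icc a' b') s' := by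
  simp only [chiStar, frontier_Icc hab, frontier_Icc hab', mem_insert_iff, mem_singleton_iff,
    h1, h2, h3]
  congr

theorem eta_eq_scale (c : ℝ) {ε : ℝ} (hε : 0 < ε) (t : ℝ) :
    eta c ε t = 1 / ε * eta c 1 (t / ε) := by
  have h : chiStar (Icc (-ε) ε) t = chiStar (Icc (-1) 1) (t / ε) := by
    refine chiStar_Icc_eq_of_iff (by linarith) (by norm_num) ?_ ?_ ?_
    · rw [div_eq_iff hε.ne', neg_one_mul]
    · rw [div_eq_iff hε.ne', one_mul]
    · rw [mem_Icc, mem_Icc, le_div_iff₀ hε, div_le_iff₀ hε, neg_one_mul, one_mul]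
  rw [eta, eta, h, div_one]
  field_simp

theorem eta_nonneg {c ε : ℝ} (hc : 0 < c) (hε : 0 < ε) (t : ℝ) : 0 ≤ eta c ε t := by
  have : 0 < Real.sinh c := Real.sinh_pos_iff.mpr hc
  exact mul_nonneg (chiStar_nonneg _ _) (mul_nonneg (by positivity) (besselI0_nonneg _))

theorem eta_neg {c ε : ℝ} (hε : 0 < ε) (t : ℝ) : eta c ε (-t) = eta c ε t := by
  have h : chiStar (Icc (-ε) ε) (-t) = chiStar (Icc (-ε) ε) t := by
    simp only [chiStar, frontier_Icc (show -ε ≤ ε by linarith), mem_insert_iff, mem_singleton_iff,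
      mem_Icc]
    refine if_congr ?_ rfl (if_congr ?_ rfl rfl)
    · rw [neg_inj, neg_eq_iff_eq_neg, or_comm]
    · rw [neg_le_neg_iff, neg_le, and_comm]
  rw [eta, eta, h, neg_div, neg_sq]

theorem eta_eq_zero {c ε : ℝ} (hε : 0 < ε) {t : ℝ} (ht : t ∉ Icc (-ε) ε) : eta c ε t = 0 := by
  rw [eta, chiStar_Icc_of_notMem (by linarith) ht, zero_mul]

theorem eta_one_ae_eq (c : ℝ) : eta c 1 =ᵐ[volume] (Icc (-1 : ℝ) 1).indicator
    (fun t => c / (2 * Real.sinh c) * besselI0 (c * √(1 - t ^ 2))) := by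
  have h1 : ∀ᵐ t : ℝ, t ≠ -1 := by simp [ae_iff]
  have h2 : ∀ᵐ t : ℝ, t ≠ 1 := by simp [ae_iff]
  filter_upwards [h1, h2] with t ht1 ht2
  by_cases h : t ∈ Icc (-1 : ℝ) 1
  · rw [indicator_of_mem h, eta, chiStar_Icc_of_mem_Ioo
      ⟨lt_of_le_of_ne h.1 (Ne.symm ht1), lt_of_le_of_ne h.2 ht2⟩, one_mul, mul_one, div_one]
  · rw [indicator_of_notMem h, eta_eq_zero one_pos h]

theorem continuous_besselI0_sqrt (c : ℝ) :
    Continuous fun t : ℝ => c / (2 * Real.sinh c) * besselI0 (c * √(1 - t ^ 2)) :=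
  continuous_const.mul (continuous_besselI0.comp (by fun_prop))

theorem mul_eta_one_ae_eq (c : ℝ) (f : ℝ → ℝ) : (fun t => f t * eta c 1 t) =ᵐ[volume]
    (Icc (-1 : ℝ) 1).indicator
      (fun t => f t * (c / (2 * Real.sinh c) * besselI0 (c * √(1 - t ^ 2)))) := by
  filter_upwards [eta_one_ae_eq c] with t ht
  rw [ht]
  by_cases h : t ∈ Icc (-1 : ℝ) 1 <;> simp [h]

theorem integrable_mul_eta_one (c : ℝ) {f : ℝ → ℝ} (hf : Continuous f) :
    Integrable fun t => f t * eta c 1 t := by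
  rw [integrable_congr (mul_eta_one_ae_eq c f), integrable_indicator_iff measurableSet_Icc]
  exact (hf.mul (continuous_besselI0_sqrt c)).continuousOn.integrableOn_compact isCompact_Icc

theorem integrable_mul_eta (c : ℝ) {ε : ℝ} (hε : 0 < ε) {f : ℝ → ℝ} (hf : Continuous f) :
    Integrable fun t => f t * eta c ε t := by
  have h := (integrable_mul_eta_one c (f := fun t => f (t * ε)) (by fun_prop)).comp_div hε.ne'
  refine (h.mul_const (1 / ε)).congr (Filter.Eventually.of_forall fun t => ?_)
  simp only
  rw [eta_eq_scale c hε, div_mul_cancel₀ _ hε.ne']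
  ring

theorem integrable_eta_one (c : ℝ) : Integrable (eta c 1) := by
  simpa using integrable_mul_eta_one c (f := fun _ => 1) continuous_const

theorem integrable_eta (c : ℝ) {ε : ℝ} (hε : 0 < ε) : Integrable (eta c ε) := by
  simpa using integrable_mul_eta c hε (f := fun _ => 1) continuous_const

theorem integral_exp_mul_eta_one (b : ℝ) {c : ℝ} (hc : 0 < c) :
    ∫ t, Real.exp (b * t) * eta c 1 t =
      c / Real.sinh c * (Real.sinh (√(b ^ 2 + c ^ 2)) / √(b ^ 2 + c ^ 2)) := by
  have : 0 < Real.sinh c := Real.sinh_pos_iff.mpr hc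
  rw [integral_congr_ae (mul_eta_one_ae_eq c _), integral_indicator measurableSet_Icc,
    integral_Icc_eq_integral_Ioc, ← intervalIntegral.integral_of_le (by norm_num)]
  simp_rw [mul_left_comm (Real.exp _)]
  rw [intervalIntegral.integral_const_mul, integral_exp_mul_besselI0 b hc]
  field_simp

theorem integral_eta_one {c : ℝ} (hc : 0 < c) : ∫ t, eta c 1 t = 1 := by
  have h := integral_exp_mul_eta_one 0 hc
  have : 0 < Real.sinh c := Real.sinh_pos_iff.mpr hc
  simp only [zero_mul, Real.exp_zero, one_mul, ne_eq, OfNat.ofNat_ne_zero, not_false_eq_true,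
    zero_pow, zero_add, Real.sqrt_sq hc.le] at h
  rw [h]
  field_simp

/-- This identifies `λ` as exactly the normalization that makes the smoothed cutoff equal to 1 far
to the left. -/
theorem integral_exp_neg_mul_eta {c ε : ℝ} (hc : 0 < c) (hε : 0 < ε) :
    ∫ t, Real.exp (-t / 2) * eta c ε t = loganLambda c ε := by
  have h := integral_exp_mul_eta_one (-(ε / 2)) hc
  rw [neg_sq] at h
  rw [loganLambda_eq c ε hc, ← h]
  have hs := Measure.integral_comp_div (fun t => Real.exp (-(ε / 2) * t) * eta c 1 t) ε
  rw [abs_of_pos hε, smul_eq_mul] at hs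
  have : ∀ t, Real.exp (-t / 2) * eta c ε t
      = 1 / ε * (Real.exp (-(ε / 2) * (t / ε)) * eta c 1 (t / ε)) := by
    intro t
    rw [eta_eq_scale c hε, show -(ε / 2) * (t / ε) = -t / 2 by field_simp]
    ring
  simp_rw [this]
  rw [integral_const_mul, hs]
  field_simp

/-- The mass of `η_{c,1}` to the right of `s`. -/
noncomputable def etaTail (c s : ℝ) : ℝ := ∫ τ in Ioi s, eta c 1 τ

theorem integral_Iic_eta_one (c s : ℝ) : ∫ τ in Iic s, eta c 1 τ = etaTail c (-s) := by
  rw [etaTail, ← integral_comp_neg_Iic]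
  simp_rw [eta_neg one_pos]

theorem integral_Ioi_eta (c : ℝ) {ε : ℝ} (hε : 0 < ε) (u : ℝ) :
    ∫ τ in Ioi u, eta c ε τ = etaTail c (u / ε) := by
  have h := integral_comp_mul_left_Ioi (eta c 1) u (inv_pos.mpr hε)
  rw [inv_inv, smul_eq_mul] at h
  rw [etaTail, show u / ε = ε⁻¹ * u by ring]
  have : ∀ t, eta c ε t = ε⁻¹ * eta c 1 (ε⁻¹ * t) := by
    intro t
    rw [eta_eq_scale c hε, one_div, inv_mul_eq_div ε t]
  simp_rw [this]
  rw [integral_const_mul, h]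
  field_simp

theorem integral_Iic_eta (c : ℝ) {ε : ℝ} (hε : 0 < ε) (u : ℝ) :
    ∫ τ in Iic u, eta c ε τ = etaTail c (-u / ε) := by
  rw [← integral_Ioi_eta c hε, ← integral_comp_neg_Iic]
  simp_rw [eta_neg hε]

theorem etaTail_nonneg {c : ℝ} (hc : 0 < c) (s : ℝ) : 0 ≤ etaTail c s :=
  setIntegral_nonneg measurableSet_Ioi fun t _ => eta_nonneg hc one_pos t

theorem etaTail_antitone {c : ℝ} (hc : 0 < c) : Antitone (etaTail c) := fun _ _ h =>
  setIntegral_mono_set (integrable_eta_one c).integrableOn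
    (Filter.Eventually.of_forall fun t => eta_nonneg hc one_pos t) (Ioi_subset_Ioi h).eventuallyLE

theorem etaTail_eq_zero (c : ℝ) {s : ℝ} (hs : 1 ≤ s) : etaTail c s = 0 := by
  refine setIntegral_eq_zero_of_forall_eq_zero fun t ht => eta_eq_zero one_pos fun h => ?_
  rw [mem_Ioi] at ht
  linarith [h.2]

theorem etaTail_add_neg {c : ℝ} (hc : 0 < c) (s : ℝ) : etaTail c (-s) + etaTail c s = 1 := by
  rw [← integral_Iic_eta_one, etaTail, ← compl_Iic,
    integral_add_compl measurableSet_Iic (integrable_eta_one c), integral_eta_one hc]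

theorem etaTail_zero {c : ℝ} (hc : 0 < c) : etaTail c 0 = 1 / 2 := by
  have := etaTail_add_neg hc 0
  rw [neg_zero] at this
  linarith

theorem etaTail_eq_intervalIntegral (c s : ℝ) : etaTail c s = ∫ τ in s..1, eta c 1 τ := by
  have := intervalIntegral.integral_Ioi_sub_Ioi' (a := s) (b := 1) (μ := volume) (f := eta c 1)
    (integrable_eta_one c).integrableOn (integrable_eta_one c).integrableOn
  have h1 := etaTail_eq_zero c le_rfl
  rw [etaTail] at h1 ⊢
  rw [h1, sub_zero] at this
  exact this

theorem continuous_etaTail (c : ℝ) : Continuous (etaTail c) := by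
  have h : Continuous fun s => ∫ τ in (1 : ℝ)..s, eta c 1 τ :=
    intervalIntegral.continuous_primitive
      (fun a b => (integrable_eta_one c).intervalIntegrable) 1
  convert h.neg using 1
  ext s
  rw [etaTail_eq_intervalIntegral, intervalIntegral.integral_symm]
  rfl

theorem muFun_one_of_pos (c : ℝ) {t : ℝ} (ht : 0 < t) : muFun c 1 t = etaTail c t := by
  rw [muFun, if_neg (by linarith), if_pos ht, integral_Iic_eta_one, neg_neg]

theorem muFun_neg (c ε t : ℝ) : muFun c ε (-t) = -muFun c ε t := by
  rcases lt_trichotomy t 0 with h | h | h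
  · rw [muFun, muFun, if_neg (by linarith), if_pos (by linarith), if_pos h, neg_neg, neg_neg]
  · simp [muFun, h]
  · rw [muFun, muFun, if_pos (by linarith), if_neg (by linarith), if_pos h]

/-- To the right of 0, `μ_c` is the continuous function `etaTail c`. At `α = 0` the right limit is
`1/2` although `μ_c(0) = 0`. -/
theorem rightLim_muFun_one (c : ℝ) {α : ℝ} (hα : 0 ≤ α) :
    Function.rightLim (muFun c 1) α = etaTail c α := by
  refine rightLim_eq_of_tendsto ?_
  have h : Filter.Tendsto (etaTail c) (nhdsWithin α (Ioi α)) (nhds (etaTail c α)) :=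
    (continuous_etaTail c).continuousWithinAt
  refine h.congr' ?_
  filter_upwards [self_mem_nhdsWithin] with t ht
  rw [muFun_one_of_pos c (hα.trans_lt ht)]

theorem integrableOn_etaTail_Ioi (c : ℝ) {α : ℝ} (hα : 0 ≤ α) :
    IntegrableOn (etaTail c) (Ioi α) := by
  have h : IntegrableOn (etaTail c) (Icc 0 1) :=
    (continuous_etaTail c).continuousOn.integrableOn_compact isCompact_Icc
  refine IntegrableOn.mono_set (s := Ioi α) ?_ Subset.rfl
  refine (h.of_forall_sdiff_eq_zero (t := Ioi α ∪ Icc 0 1)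
    (measurableSet_Ioi.union measurableSet_Icc) fun t ht => etaTail_eq_zero c ?_).mono_set
    subset_union_left
  rcases ht with ⟨h1 | h1, h2⟩
  · by_contra hlt
    exact h2 ⟨hα.trans (le_of_lt h1), by linarith⟩
  · exact absurd h1 h2

theorem integral_Ioi_etaTail (c : ℝ) {α : ℝ} (hα₀ : 0 ≤ α) :
    ∫ t in Ioi α, etaTail c t = ∫ t in α..1, etaTail c t := by
  have := intervalIntegral.integral_Ioi_sub_Ioi' (a := α) (b := 1) (μ := volume) (f := etaTail c)
    (integrableOn_etaTail_Ioi c hα₀) (integrableOn_etaTail_Ioi c zero_le_one)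
  rw [← this, setIntegral_eq_zero_of_forall_eq_zero (t := Ioi 1), sub_zero]
  exact fun t ht => etaTail_eq_zero c (le_of_lt ht)

/-- `μ_c` is odd and integrable, so its full integral vanishes and the integral up to `α` is minus
the integral beyond `α`. -/
theorem nuFun_one_eq (c : ℝ) {α : ℝ} (hα₀ : 0 ≤ α) :
    nuFun c 1 α = -∫ t in α..1, etaTail c t := by
  have hM : Integrable ((Ioi (0 : ℝ)).indicator (etaTail c)) :=
    (integrable_indicator_iff measurableSet_Ioi).mpr (integrableOn_etaTail_Ioi c le_rfl)
  have hint : Integrable (muFun c 1) := by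
    refine (hM.sub hM.comp_neg).congr (Filter.Eventually.of_forall fun t => ?_)
    simp only [Pi.sub_apply, indicator, mem_Ioi]
    rcases lt_trichotomy t 0 with h | h | h
    · rw [if_neg (by linarith), if_pos (by linarith), ← muFun_one_of_pos c (by linarith),
        muFun_neg]
      ring
    · simp [muFun, h]
    · rw [if_neg (by linarith : ¬ 0 < -t), if_pos h, muFun_one_of_pos c h, sub_zero]
  have hzero : ∫ t, muFun c 1 t = 0 := by
    have h := integral_neg_eq_self (muFun c 1) volume
    simp_rw [muFun_neg] at h
    rw [integral_neg] at h
    linarith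
  have hsum := integral_add_compl (measurableSet_Iic (a := α)) hint
  rw [compl_Iic, hzero, setIntegral_congr_fun measurableSet_Ioi
    (fun t ht => muFun_one_of_pos c (hα₀.trans_lt ht)), integral_Ioi_etaTail c hα₀] at hsum
  rw [nuFun]
  linarith

theorem abs_nuFun_one {c : ℝ} (hc : 0 < c) {α : ℝ} (hα₀ : 0 ≤ α) (hα : α ≤ 1) :
    |nuFun c 1 α| = ∫ t in α..1, etaTail c t := by
  rw [nuFun_one_eq c hα₀, abs_neg, abs_of_nonneg]
  exact intervalIntegral.integral_nonneg hα fun t _ => etaTail_nonneg hc t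

theorem integral_eta {c ε : ℝ} (hc : 0 < c) (hε : 0 < ε) : ∫ t, eta c ε t = 1 := by
  have h := integral_add_compl (measurableSet_Iic (a := (0 : ℝ))) (integrable_eta c hε)
  rw [compl_Iic, integral_Iic_eta c hε, integral_Ioi_eta c hε, neg_zero, zero_div,
    etaTail_zero hc] at h
  linarith

/-- Integrate `e^{-t/2} ≥ 1 - t/2` against the even probability density `η`. This permits dropping
`1/λ` in upper bounds. -/
theorem one_le_loganLambda {c ε : ℝ} (hc : 0 < c) (hε : 0 < ε) : 1 ≤ loganLambda c ε := by
  have hodd : ∫ t, t * eta c ε t = 0 := by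
    have h := integral_neg_eq_self (fun t => t * eta c ε t) volume
    simp_rw [eta_neg hε, neg_mul] at h
    rw [integral_neg] at h
    linarith
  have h1 := integrable_mul_eta c hε (f := fun t => t) continuous_id
  rw [← integral_exp_neg_mul_eta hc hε]
  calc (1 : ℝ) = ∫ t, (eta c ε t - 1 / 2 * (t * eta c ε t)) := by
        rw [integral_sub (integrable_eta c hε) (h1.const_mul _), integral_const_mul, hodd,
          integral_eta hc hε]
        ring
    _ ≤ ∫ t, Real.exp (-t / 2) * eta c ε t := by
        refine integral_mono ((integrable_eta c hε).sub (h1.const_mul _))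
          (integrable_mul_eta c hε (by fun_prop)) fun t => ?_
        have h2 := Real.add_one_le_exp (-t / 2)
        have h3 := eta_nonneg hc hε t
        simp only
        nlinarith

/-- The smoothed cutoff: `e^{-t/2} φ_{x,c,ε}(t)` as a function of `t - log x`. -/
noncomputable def etaKernel (c ε u : ℝ) : ℝ :=
  1 / loganLambda c ε * ∫ s in Ioi u, Real.exp (-s / 2) * eta c ε s

theorem exp_neg_mul_phiKernel (x c : ℝ) {ε t : ℝ} (hε : 0 < ε) (ht : ε ≤ t) :
    Real.exp (-t / 2) * phiKernel x c ε t = etaKernel c ε (t - Real.log x) := by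
  have h1 : (∫ y, (Icc 0 (Real.log x)).indicator (fun s => Real.exp (s / 2)) y * eta c ε (t - y))
      = Real.exp (t / 2) * ∫ s in Ioi (t - Real.log x), Real.exp (-s / 2) * eta c ε s := by
    rw [← integral_sub_left_eq_self _ volume t, ← integral_Ici_eq_integral_Ioi,
      ← integral_indicator measurableSet_Ici, ← integral_const_mul]
    refine integral_congr_ae (Filter.Eventually.of_forall fun s => ?_)
    simp only [sub_sub_cancel]
    -- After `s = t - y`, the condition `y ≥ 0` reads `s ≤ t`, which is automatic on the support of
    -- `η` because `t ≥ ε`.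
    by_cases hs : s ∈ Icc (-ε) ε
    · by_cases hs' : t - Real.log x ≤ s
      · rw [indicator_of_mem (show t - s ∈ Icc 0 (Real.log x) from
          ⟨by linarith [hs.2], by linarith⟩), indicator_of_mem (show s ∈ Ici _ from hs'),
          ← mul_assoc, ← Real.exp_add]
        ring_nf
      · rw [indicator_of_notMem (show t - s ∉ Icc 0 (Real.log x) from
          fun h => hs' (by linarith [h.2])), indicator_of_notMem (show s ∉ Ici _ from hs')]
        ring
    · simp [eta_eq_zero hε hs, indicator]
  rw [phiKernel, h1, etaKernel]
  have h2 : Real.exp (-t / 2) * Real.exp (t / 2) = 1 := by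
    rw [← Real.exp_add, ← Real.exp_zero]
    ring_nf
  calc _ = (Real.exp (-t / 2) * Real.exp (t / 2)) * (1 / loganLambda c ε *
        ∫ s in Ioi (t - Real.log x), Real.exp (-s / 2) * eta c ε s) := by ring
    _ = _ := by rw [h2, one_mul]

theorem etaKernel_nonneg {c ε : ℝ} (hc : 0 < c) (hε : 0 < ε) (u : ℝ) : 0 ≤ etaKernel c ε u := by
  have := one_le_loganLambda hc hε
  exact mul_nonneg (by positivity) (setIntegral_nonneg measurableSet_Ioi fun s _ =>
    mul_nonneg (Real.exp_pos _).le (eta_nonneg hc hε s))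

theorem one_sub_etaKernel {c ε : ℝ} (hc : 0 < c) (hε : 0 < ε) (u : ℝ) : 1 - etaKernel c ε u =
    1 / loganLambda c ε * ∫ s in Iic u, Real.exp (-s / 2) * eta c ε s := by
  have hl := one_le_loganLambda hc hε
  have h := integral_add_compl (measurableSet_Iic (a := u))
    (integrable_mul_eta c hε (f := fun s => Real.exp (-s / 2)) (by fun_prop))
  rw [compl_Iic, integral_exp_neg_mul_eta hc hε] at h
  rw [etaKernel, eq_comm, eq_sub_iff_add_eq, ← mul_add, h]
  field_simp

theorem etaKernel_le_one {c ε : ℝ} (hc : 0 < c) (hε : 0 < ε) (u : ℝ) : etaKernel c ε u ≤ 1 := by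
  have hl := one_le_loganLambda hc hε
  have h := one_sub_etaKernel hc hε u
  have : 0 ≤ 1 / loganLambda c ε * ∫ s in Iic u, Real.exp (-s / 2) * eta c ε s :=
    mul_nonneg (by positivity) (setIntegral_nonneg measurableSet_Iic fun s _ =>
      mul_nonneg (Real.exp_pos _).le (eta_nonneg hc hε s))
  linarith

/-- On the support of `η` the factor `e^{-s/2}` is at most `e^{ε/2}`; to the right of 0, as in
`etaKernel_le`, it is at most 1. -/
theorem one_sub_etaKernel_le {c ε : ℝ} (hc : 0 < c) (hε : 0 < ε) (u : ℝ) :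
    1 - etaKernel c ε u ≤ Real.exp (ε / 2) * etaTail c (-u / ε) := by
  have hl := one_le_loganLambda hc hε
  rw [one_sub_etaKernel hc hε, ← integral_Iic_eta c hε, ← integral_const_mul (Real.exp (ε / 2))]
  have h0 : 0 ≤ ∫ s in Iic u, Real.exp (-s / 2) * eta c ε s :=
    setIntegral_nonneg measurableSet_Iic fun s _ =>
      mul_nonneg (Real.exp_pos _).le (eta_nonneg hc hε s)
  calc 1 / loganLambda c ε * ∫ s in Iic u, Real.exp (-s / 2) * eta c ε s
      ≤ 1 * ∫ s in Iic u, Real.exp (-s / 2) * eta c ε s := by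
        gcongr
        rw [div_le_one (by linarith)]
        exact hl
    _ ≤ ∫ s in Iic u, Real.exp (ε / 2) * eta c ε s := by
        rw [one_mul]
        refine setIntegral_mono
          (integrable_mul_eta c hε (f := fun s => Real.exp (-s / 2)) (by fun_prop)).integrableOn
          ((integrable_eta c hε).const_mul _).integrableOn fun s => ?_
        by_cases hs : s ∈ Icc (-ε) ε
        · have := eta_nonneg hc hε s
          have : -s ≤ ε := by linarith [hs.1]
          simp only
          gcongr
        · simp [eta_eq_zero hε hs]

theorem etaKernel_le {c ε : ℝ} (hc : 0 < c) (hε : 0 < ε) {u : ℝ} (hu : 0 ≤ u) :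
    etaKernel c ε u ≤ etaTail c (u / ε) := by
  have hl := one_le_loganLambda hc hε
  rw [etaKernel, ← integral_Ioi_eta c hε]
  have h0 : 0 ≤ ∫ s in Ioi u, Real.exp (-s / 2) * eta c ε s :=
    setIntegral_nonneg measurableSet_Ioi fun s _ =>
      mul_nonneg (Real.exp_pos _).le (eta_nonneg hc hε s)
  calc 1 / loganLambda c ε * ∫ s in Ioi u, Real.exp (-s / 2) * eta c ε s
      ≤ 1 * ∫ s in Ioi u, Real.exp (-s / 2) * eta c ε s := by
        gcongr
        rw [div_le_one (by linarith)]
        exact hl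
    _ ≤ ∫ s in Ioi u, eta c ε s := by
        rw [one_mul]
        refine setIntegral_mono_on
          (integrable_mul_eta c hε (f := fun s => Real.exp (-s / 2)) (by fun_prop)).integrableOn
          (integrable_eta c hε).integrableOn measurableSet_Ioi fun s hs => ?_
        have h1 := eta_nonneg hc hε s
        have h2 : Real.exp (-s / 2) ≤ 1 := by
          rw [Real.exp_le_one_iff]
          linarith [mem_Ioi.mp hs]
        nlinarith

theorem psiMod_eq (x c : ℝ) {ε : ℝ} (hε₀ : 0 < ε) (hε : ε < 1 / 2) :
    psiMod c ε x = ∑' q : Nat.Primes × ℕ+, Real.log (q.1 : ℝ) *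
      etaKernel c ε (Real.log ((q.1 : ℝ) ^ (q.2 : ℕ)) - Real.log x) := by
  refine tsum_congr fun q => ?_
  have hp2 : (2 : ℝ) ≤ (q.1 : ℝ) := by exact_mod_cast q.1.2.two_le
  have hm : (1 : ℝ) ≤ ((q.2 : ℕ) : ℝ) := by exact_mod_cast q.2.2
  have hlog : 1 / 2 < Real.log (q.1 : ℝ) :=
    lt_of_lt_of_le (by have := Real.log_two_gt_d9; linarith) (Real.log_le_log two_pos hp2)
  have ht : ε ≤ ((q.2 : ℕ) : ℝ) * Real.log (q.1 : ℝ) := by nlinarith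
  rw [Real.log_pow, ← exp_neg_mul_phiKernel x c hε₀ ht, Real.rpow_def_of_pos (by linarith),
    neg_div, Real.exp_neg, show Real.log (q.1 : ℝ) * (((q.2 : ℕ) : ℝ) / 2)
      = ((q.2 : ℕ) : ℝ) * Real.log (q.1 : ℝ) / 2 by ring]
  ring

end

section

/-! ### Sums over prime powers and the contribution of proper powers -/

open Finset

theorem injective_primes_pnat :
    Function.Injective fun q : Nat.Primes × ℕ+ => ((q.1 : ℕ), (q.2 : ℕ)) := by
  rintro ⟨p, m⟩ ⟨p', m'⟩ h
  simp only [Prod.mk.injEq] at h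
  exact Prod.ext (Subtype.ext h.1) (PNat.eq h.2)

theorem prime_le_and_exponent_le {p m : ℕ} (hp : p.Prime) (hm : 1 ≤ m) {b : ℝ}
    (h : (p : ℝ) ^ m ≤ b) : p ≤ ⌊b⌋₊ ∧ m ≤ Nat.log 2 ⌊b⌋₊ := by
  have h1 : p ^ m ≤ ⌊b⌋₊ := Nat.le_floor (by exact_mod_cast h)
  refine ⟨(Nat.le_self_pow (by omega) p).trans h1, ?_⟩
  exact Nat.le_log_of_pow_le one_lt_two ((Nat.pow_le_pow_left hp.two_le m).trans h1)

theorem finite_primePow_le (b : ℝ) :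
    {q : Nat.Primes × ℕ+ | (q.1 : ℝ) ^ (q.2 : ℕ) ≤ b}.Finite := by
  refine Set.Finite.subset (Set.Finite.preimage injective_primes_pnat.injOn
    ((Set.finite_Iic ⌊b⌋₊).prod (Set.finite_Iic (Nat.log 2 ⌊b⌋₊)))) fun q hq => ?_
  exact prime_le_and_exponent_le q.1.2 q.2.2 hq

theorem summable_of_primePow_le {f : Nat.Primes × ℕ+ → ℝ} (b : ℝ)
    (hf : ∀ q, b < (q.1 : ℝ) ^ (q.2 : ℕ) → f q = 0) : Summable f := by
  refine summable_of_hasFiniteSupport ((finite_primePow_le b).subset fun q hq => ?_)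
  by_contra h
  exact hq (hf q (not_le.mp h))

theorem tsum_primes_pnat_eq_sum {F : ℕ → ℕ → ℝ} {N M : ℕ}
    (hF : ∀ p m, p.Prime → 1 ≤ m → F p m ≠ 0 → p ≤ N ∧ m ≤ M) :
    ∑' q : Nat.Primes × ℕ+, F q.1 q.2 =
      ∑ m ∈ Finset.Icc 1 M, ∑ p ∈ (Finset.Icc 1 N).filter Nat.Prime, F p m := by
  classical
  let G : ℕ × ℕ → ℝ := fun r => if r.1.Prime ∧ 1 ≤ r.2 then F r.1 r.2 else 0
  have h1 : ∑' q : Nat.Primes × ℕ+, F q.1 q.2 = ∑' r, G r := by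
    rw [← injective_primes_pnat.tsum_eq]
    · refine tsum_congr fun q => ?_
      simp only [G]
      rw [if_pos ⟨q.1.2, q.2.2⟩]
    · intro r hr
      have hc : r.1.Prime ∧ 1 ≤ r.2 := by
        by_contra h
        exact hr (if_neg h)
      exact ⟨(⟨r.1, hc.1⟩, ⟨r.2, hc.2⟩), rfl⟩
  rw [h1, tsum_eq_sum (s := (Finset.Icc 1 N).filter Nat.Prime ×ˢ Finset.Icc 1 M),
    Finset.sum_product_right]
  · refine Finset.sum_congr rfl fun m hm => Finset.sum_congr rfl fun p hp => ?_
    simp only [G]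
    rw [if_pos ⟨(Finset.mem_filter.mp hp).2, (Finset.mem_Icc.mp hm).1⟩]
  · intro r hr
    by_contra h
    have hc : r.1.Prime ∧ 1 ≤ r.2 := by
      by_contra h'
      exact h (if_neg h')
    have hne : F r.1 r.2 ≠ 0 := by
      simpa only [G, if_pos hc] using h
    obtain ⟨h2, h3⟩ := hF r.1 r.2 hc.1 hc.2 hne
    apply hr
    simp only [Finset.mem_product, Finset.mem_filter, Finset.mem_Icc]
    exact ⟨⟨⟨hc.1.one_lt.le, h2⟩, hc.1⟩, hc.2, h3⟩

theorem card_filter_Icc_real_le (N : ℕ) {A B : ℝ} (hA : 0 ≤ A) (hAB : A ≤ B) :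
    (((Finset.Icc 1 N).filter fun n : ℕ => A ≤ n ∧ (n : ℝ) ≤ B).card : ℝ) ≤ B - A + 1 := by
  have hsub : ((Finset.Icc 1 N).filter fun n : ℕ => A ≤ n ∧ (n : ℝ) ≤ B)
      ⊆ Finset.Icc ⌈A⌉₊ ⌊B⌋₊ := by
    intro n hn
    obtain ⟨-, h1, h2⟩ := Finset.mem_filter.mp hn
    exact Finset.mem_Icc.mpr ⟨Nat.ceil_le.mpr h1, Nat.le_floor h2⟩
  have hcard := Finset.card_le_card hsub
  rw [Nat.card_Icc] at hcard
  have h1 := Nat.le_ceil A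
  have h2 := Nat.floor_le (hA.trans hAB)
  have h3 : ((⌊B⌋₊ + 1 - ⌈A⌉₊ : ℕ) : ℝ) ≤ B - A + 1 := by
    rcases le_total ⌈A⌉₊ (⌊B⌋₊ + 1) with h | h
    · rw [Nat.cast_sub h]
      push_cast
      linarith
    · rw [Nat.sub_eq_zero_of_le h]
      push_cast
      linarith
  exact le_trans (by exact_mod_cast hcard) h3

/-- A short interval contains few `m`-th powers. -/
theorem card_filter_pow_le (N : ℕ) {a b ε : ℝ} (ha : 1 ≤ a) (hab : a ≤ b)
    (hba : b ≤ Real.exp ε * a) {m : ℕ} (hm : 2 ≤ m) :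
    (((Finset.Icc 1 N).filter fun n : ℕ => a ≤ (n : ℝ) ^ m ∧ (n : ℝ) ^ m ≤ b).card : ℝ)
      ≤ ε * √b / m + 1 := by
  have hm0 : (0 : ℝ) < m := by positivity
  have ha0 : 0 < a := by linarith
  have hb0 : 0 < b := by linarith
  have hε : 0 ≤ ε := by
    by_contra h
    have : Real.exp ε < 1 := by simpa using h
    nlinarith
  set A := a ^ (1 / (m : ℝ)) with hA
  set B := b ^ (1 / (m : ℝ)) with hB
  have hA0 : 0 ≤ A := by positivity
  have hB0 : 0 ≤ B := by positivity
  have hAB : A ≤ B := by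
    rw [hA, hB]
    gcongr
  have hAm : A ^ m = a := by
    rw [hA, one_div]
    exact Real.rpow_inv_natCast_pow ha0.le (by omega)
  have hBm : B ^ m = b := by
    rw [hB, one_div]
    exact Real.rpow_inv_natCast_pow hb0.le (by omega)
  have hBs : B ≤ √b := by
    rw [hB, Real.sqrt_eq_rpow]
    apply Real.rpow_le_rpow_of_exponent_le (by linarith)
    have : (2 : ℝ) ≤ m := by exact_mod_cast hm
    gcongr
  -- The `m`-th roots satisfy `B ≤ e^{ε/m} A`, so `B - A ≤ B (1 - e^{-ε/m})`.
  have hBA : B - A ≤ ε * B / m := by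
    have h1 : B ≤ Real.exp (ε / m) * A := by
      have : Real.exp (ε / m) * A = (Real.exp ε * a) ^ (1 / (m : ℝ)) := by
        rw [Real.mul_rpow (Real.exp_pos _).le ha0.le, ← Real.exp_mul]
        congr 2
        ring
      rw [this, hB]
      gcongr
    have h2 : Real.exp (-(ε / m)) * B ≤ A := by
      rw [Real.exp_neg, inv_mul_le_iff₀ (Real.exp_pos _)]
      exact h1
    have h3 := Real.add_one_le_exp (-(ε / m))
    have h4 : (-(ε / m) + 1) * B ≤ Real.exp (-(ε / m)) * B := by gcongr
    have h5 : ε * B / m = ε / m * B := by ring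
    rw [h5]
    linarith
  have hfilter : ((Finset.Icc 1 N).filter fun n : ℕ => a ≤ (n : ℝ) ^ m ∧ (n : ℝ) ^ m ≤ b)
      ⊆ (Finset.Icc 1 N).filter fun n : ℕ => A ≤ n ∧ (n : ℝ) ≤ B := by
    intro n hn
    obtain ⟨h0, h1, h2⟩ := Finset.mem_filter.mp hn
    refine Finset.mem_filter.mpr ⟨h0, ?_, ?_⟩
    · rw [← hAm] at h1
      exact le_of_pow_le_pow_left₀ (by omega) (by positivity) h1
    · rw [← hBm] at h2
      exact le_of_pow_le_pow_left₀ (by omega) hB0 h2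
  calc (((Finset.Icc 1 N).filter fun n : ℕ => a ≤ (n : ℝ) ^ m ∧ (n : ℝ) ^ m ≤ b).card : ℝ)
      ≤ (((Finset.Icc 1 N).filter fun n : ℕ => A ≤ n ∧ (n : ℝ) ≤ B).card : ℝ) := by
        exact_mod_cast Finset.card_le_card hfilter
    _ ≤ B - A + 1 := card_filter_Icc_real_le N hA0 hAB
    _ ≤ ε * B / m + 1 := by linarith
    _ ≤ ε * √b / m + 1 := by gcongr

theorem sum_one_div_sq_le (M : ℕ) : ∑ m ∈ Finset.Icc 2 (M + 1), 1 / (m : ℝ) ^ 2 ≤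
    1 - 1 / ((M : ℝ) + 1) := by
  induction M with
  | zero => simp
  | succ M ih =>
    rw [Finset.sum_Icc_succ_top (by omega)]
    have h : 1 / ((M + 1 + 1 : ℕ) : ℝ) ^ 2 ≤ 1 / ((M : ℝ) + 1) - 1 / (((M + 1 : ℕ) : ℝ) + 1) := by
      push_cast
      rw [div_sub_div _ _ (by positivity) (by positivity),
        div_le_div_iff₀ (by positivity) (by positivity)]
      nlinarith [(Nat.cast_nonneg M : (0 : ℝ) ≤ M)]
    linarith

theorem sum_one_div_le_log (M : ℕ) : ∑ m ∈ Finset.Icc 2 (M + 1), 1 / (m : ℝ) ≤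
    Real.log ((M : ℝ) + 1) := by
  induction M with
  | zero => simp
  | succ M ih =>
    rw [Finset.sum_Icc_succ_top (by omega)]
    have h : 1 / ((M + 1 + 1 : ℕ) : ℝ) ≤ Real.log (((M + 1 : ℕ) : ℝ) + 1) - Real.log ((M : ℝ) + 1) := by
      push_cast
      have h1 := Real.log_le_sub_one_of_pos (show (0 : ℝ) < ((M : ℝ) + 1) / (M + 1 + 1) by positivity)
      rw [Real.log_div (by positivity) (by positivity)] at h1
      have h2 : ((M : ℝ) + 1) / (M + 1 + 1) - 1 = -(1 / (M + 1 + 1)) := by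
        field_simp
        ring
      linarith
    linarith

/-- Reduction of a weighted sum over prime powers in a short interval to the sum over primes. -/
theorem tsum_primePow_le {w : ℝ → ℝ} {a b ε : ℝ} (ha : 2 ≤ a) (hab : a ≤ b)
    (hba : b ≤ Real.exp ε * a) (hw0 : ∀ t, 0 ≤ w t) (hw : ∀ t, w t ≤ 1 / 2)
    (hsupp : ∀ t, w t ≠ 0 → a ≤ t ∧ t ≤ b) :
    ∑' q : Nat.Primes × ℕ+, Real.log (q.1 : ℝ) * w ((q.1 : ℝ) ^ (q.2 : ℕ)) ≤
      Real.log b * (∑ p ∈ (Finset.Icc 1 ⌊b⌋₊).filter Nat.Prime, w p + 1 / 2 * ε * √b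
        + 1 / 2 * Real.log (Real.log b / Real.log 2)) := by
  set N := ⌊b⌋₊ with hN
  set M := Nat.log 2 N with hM
  set P := (Finset.Icc 1 N).filter Nat.Prime with hP
  have hb2 : 2 ≤ b := ha.trans hab
  have hN2 : 2 ≤ N := Nat.le_floor (by exact_mod_cast hb2)
  have hM1 : 1 ≤ M := Nat.le_log_of_pow_le one_lt_two (by simpa using hN2)
  have hlogb : 0 < Real.log b := Real.log_pos (by linarith)
  have hl2 : 0 < Real.log 2 := Real.log_pos one_lt_two
  have hε : 0 ≤ ε := by
    by_contra h
    have : Real.exp ε < 1 := by simpa using h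
    nlinarith
  rw [tsum_primes_pnat_eq_sum (F := fun p m => Real.log p * w ((p : ℝ) ^ m)) (N := N) (M := M)
    (fun p m hp hm h => prime_le_and_exponent_le hp hm (hsupp _ (right_ne_zero_of_mul h)).2)]
  -- On the support `p^m ≤ b`, so `log p ≤ log b / m`.
  have hterm : ∀ m ∈ Finset.Icc 1 M, ∑ p ∈ P, Real.log p * w ((p : ℝ) ^ m) ≤
      Real.log b * (1 / m * ∑ p ∈ P, w ((p : ℝ) ^ m)) := by
    intro m hm
    have hm1 : (0 : ℝ) < m := by exact_mod_cast (Finset.mem_Icc.mp hm).1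
    rw [Finset.mul_sum, Finset.mul_sum]
    refine Finset.sum_le_sum fun p hp => ?_
    have hpp := (Finset.mem_filter.mp hp).2
    rcases eq_or_ne (w ((p : ℝ) ^ m)) 0 with h | h
    · simp [h]
    · have h1 := (hsupp _ h).2
      have hp0 : (0 : ℝ) < p := by exact_mod_cast hpp.pos
      have h2 := Real.log_le_log (by positivity) h1
      rw [Real.log_pow] at h2
      have h3 : Real.log p ≤ Real.log b / m := by
        rw [le_div_iff₀ hm1]
        linarith
      calc Real.log p * w ((p : ℝ) ^ m) ≤ Real.log b / m * w ((p : ℝ) ^ m) := by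
            gcongr
            exact hw0 _
        _ = _ := by ring
  -- Primality is discarded: all `m`-th powers in the interval are counted with weight `1/2`.
  -- Summing over `m` then needs only `∑ 1/m² ≤ 1` and `∑ 1/m ≤ log M`.
  have hpow : ∀ m ∈ Finset.Icc 2 M, 1 / m * ∑ p ∈ P, w ((p : ℝ) ^ m) ≤
      1 / 2 * ε * √b * (1 / (m : ℝ) ^ 2) + 1 / 2 * (1 / (m : ℝ)) := by
    intro m hm
    have hm2 := (Finset.mem_Icc.mp hm).1
    have hm0 : (0 : ℝ) < m := by positivity
    have h1 : ∑ p ∈ P, w ((p : ℝ) ^ m) ≤ 1 / 2 * (ε * √b / m + 1) := by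
      calc ∑ p ∈ P, w ((p : ℝ) ^ m)
          ≤ ∑ n ∈ (Finset.Icc 1 N).filter (fun n : ℕ => a ≤ (n : ℝ) ^ m ∧ (n : ℝ) ^ m ≤ b),
            w ((n : ℝ) ^ m) := by
            rw [Finset.sum_filter, Finset.sum_filter]
            refine Finset.sum_le_sum fun n _ => ?_
            by_cases hz : w ((n : ℝ) ^ m) = 0
            · simp [hz]
            · rw [if_pos (hsupp _ hz)]
              split_ifs
              · exact le_rfl
              · exact hw0 _
        _ ≤ ∑ n ∈ (Finset.Icc 1 N).filter (fun n : ℕ => a ≤ (n : ℝ) ^ m ∧ (n : ℝ) ^ m ≤ b),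
            (1 / 2 : ℝ) := Finset.sum_le_sum fun n _ => hw _
        _ = 1 / 2 * (((Finset.Icc 1 N).filter
            (fun n : ℕ => a ≤ (n : ℝ) ^ m ∧ (n : ℝ) ^ m ≤ b)).card : ℝ) := by
            rw [Finset.sum_const, nsmul_eq_mul, mul_comm]
        _ ≤ _ := by
            gcongr
            exact card_filter_pow_le N (by linarith) hab hba hm2
    calc 1 / m * ∑ p ∈ P, w ((p : ℝ) ^ m) ≤ 1 / m * (1 / 2 * (ε * √b / m + 1)) := by gcongr
      _ = _ := by
        field_simp
  clear_value M
  obtain ⟨M', rfl⟩ : ∃ M', M = M' + 1 := ⟨M - 1, by omega⟩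
  have hsplit : Finset.Icc 1 (M' + 1) = insert 1 (Finset.Icc 2 (M' + 1)) := by
    ext m
    simp only [Finset.mem_Icc, Finset.mem_insert]
    omega
  have hMlog : ((M' : ℝ) + 1) ≤ Real.log b / Real.log 2 := by
    rw [le_div_iff₀ hl2]
    have h1 : (2 : ℕ) ^ (M' + 1) ≤ N := by
      rw [hM]
      exact Nat.pow_log_le_self 2 (by omega)
    have h2 : (2 : ℝ) ^ (M' + 1) ≤ b := by
      have : ((2 ^ (M' + 1) : ℕ) : ℝ) ≤ N := by exact_mod_cast h1
      push_cast at this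
      exact this.trans (Nat.floor_le (by linarith))
    have h3 := Real.log_le_log (by positivity) h2
    rw [Real.log_pow] at h3
    push_cast at h3
    exact h3
  calc ∑ m ∈ Finset.Icc 1 (M' + 1), ∑ p ∈ P, Real.log p * w ((p : ℝ) ^ m)
      ≤ ∑ m ∈ Finset.Icc 1 (M' + 1), Real.log b * (1 / m * ∑ p ∈ P, w ((p : ℝ) ^ m)) :=
        Finset.sum_le_sum hterm
    _ = Real.log b * (∑ p ∈ P, w p
        + ∑ m ∈ Finset.Icc 2 (M' + 1), 1 / m * ∑ p ∈ P, w ((p : ℝ) ^ m)) := by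
        rw [← Finset.mul_sum, hsplit, Finset.sum_insert (by simp)]
        simp
    _ ≤ Real.log b * (∑ p ∈ P, w p + ∑ m ∈ Finset.Icc 2 (M' + 1),
        (1 / 2 * ε * √b * (1 / (m : ℝ) ^ 2) + 1 / 2 * (1 / (m : ℝ)))) := by
        gcongr with m hm
        exact hpow m hm
    _ ≤ Real.log b * (∑ p ∈ P, w p + 1 / 2 * ε * √b
        + 1 / 2 * Real.log (Real.log b / Real.log 2)) := by
        rw [Finset.sum_add_distrib, ← Finset.mul_sum, ← Finset.mul_sum]
        have h1 := sum_one_div_sq_le M'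
        have h2 := (sum_one_div_le_log M').trans (Real.log_le_log (by positivity) hMlog)
        have h3 : 0 < 1 / ((M' : ℝ) + 1) := by positivity
        have h4 : 1 / 2 * ε * √b * ∑ m ∈ Finset.Icc 2 (M' + 1), 1 / (m : ℝ) ^ 2
            ≤ 1 / 2 * ε * √b * 1 := by
          gcongr
          linarith
        refine mul_le_mul_of_nonneg_left ?_ hlogb.le
        linarith

end

section

/-! ### The weighted prime power sum in a short interval -/

open MeasureTheory Set

theorem integral_etaTail_le {c : ℝ} (hc : 0 < c) {α : ℝ} (hα₀ : 0 ≤ α) (hα : α ≤ 1) :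
    ∫ t in α..1, etaTail c t ≤ etaTail c α := by
  calc ∫ t in α..1, etaTail c t ≤ ∫ _ in α..1, etaTail c α :=
        intervalIntegral.integral_mono_on hα ((continuous_etaTail c).intervalIntegrable _ _)
          (by simp) fun t ht => etaTail_antitone hc ht.1
    _ = (1 - α) * etaTail c α := by simp
    _ ≤ 1 * etaTail c α := by
        gcongr
        · exact etaTail_nonneg hc α
        · linarith
    _ = etaTail c α := one_mul _

/-- The substitution `t = x e^{σ ε s}` in the integral of the weight function. -/
theorem integral_etaTail_log (c : ℝ) {x ε σ : ℝ} (hx : 0 < x) (hε : 0 < ε) (hσ : σ ^ 2 = 1)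
    (α : ℝ) :
    ∫ t in (x * Real.exp (σ * (ε * α)))..(x * Real.exp (σ * (ε * 1))),
      etaTail c (σ * (Real.log t - Real.log x) / ε) =
      σ * (ε * x) * ∫ s in α..1, etaTail c s * Real.exp (σ * (ε * s)) := by
  have hderiv : ∀ s ∈ uIcc α 1, HasDerivAt (fun s => x * Real.exp (σ * (ε * s)))
      (x * (Real.exp (σ * (ε * s)) * (σ * (ε * 1)))) s := by
    intro s _
    exact ((((hasDerivAt_id s).const_mul ε).const_mul σ).exp).const_mul x
  have h := intervalIntegral.integral_comp_mul_deriv' (a := α) (b := 1)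
    (g := fun t => etaTail c (σ * (Real.log t - Real.log x) / ε)) hderiv (by fun_prop) ?_
  · rw [← h, ← intervalIntegral.integral_const_mul]
    refine intervalIntegral.integral_congr fun s _ => ?_
    simp only [Function.comp]
    rw [Real.log_mul hx.ne' (Real.exp_ne_zero _), Real.log_exp]
    have : σ * (Real.log x + σ * (ε * s) - Real.log x) / ε = s := by
      rw [add_sub_cancel_left, ← mul_assoc, ← sq, hσ]
      field_simp
    rw [this]
    ring
  · refine (continuous_etaTail c).comp_continuousOn ?_
    refine ContinuousOn.div_const (continuousOn_const.mul (ContinuousOn.sub ?_ continuousOn_const)) _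
    refine Real.continuousOn_log.mono ?_
    rintro t ⟨s, -, rfl⟩
    have : 0 < x * Real.exp (σ * (ε * s)) := by positivity
    exact this.ne'

theorem integral_etaTail_mul_exp_le {c : ℝ} (hc : 0 < c) {ε σ α : ℝ} (hε : 0 < ε)
    (hσ : σ ≤ 1) (hα₀ : 0 ≤ α) (hα : α ≤ 1) :
    ∫ s in α..1, etaTail c s * Real.exp (σ * (ε * s)) ≤
      Real.exp ε * ∫ s in α..1, etaTail c s := by
  have hcont := continuous_etaTail c
  rw [← intervalIntegral.integral_const_mul]
  refine intervalIntegral.integral_mono_on hα (Continuous.intervalIntegrable (by fun_prop) _ _)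
    (Continuous.intervalIntegrable (by fun_prop) _ _) fun s hs => ?_
  rw [mul_comm (Real.exp ε)]
  have h1 : σ * (ε * s) ≤ ε := by
    have h2 : 0 ≤ ε * s := mul_nonneg hε.le (hα₀.trans hs.1)
    nlinarith [hs.2]
  gcongr
  exact etaTail_nonneg hc s

/-- The weighted sum over the primes in a short interval. -/
theorem sum_primes_weight_le {x c ε α : ℝ} (hc : 0 < c) (hα₀ : 0 ≤ α) (hα₁ : α < 1)
    (hx : 100 < x) (hε₀ : 0 < ε) (hε : ε < 1 / 100) (hB : 1 < boundB x c ε α)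
    {w : ℝ → ℝ} {a b W : ℝ} (ha : 0.99 * x ≤ a) (hw0 : ∀ t, 0 ≤ w t)
    (hsupp : ∀ t, w t ≠ 0 → a ≤ t ∧ t ≤ b)
    (hdisc : ∀ D : ℕ, 0 < D →
      |∑' k : ℤ, w (((D * (2 * k + 1) : ℤ)) : ℝ) - W / 2 * (1 / D)| ≤ etaTail c α)
    (hW : W ≤ Real.exp ε * (ε * x * |nuFun c 1 α|)) :
    ∑ p ∈ (Finset.Icc 1 ⌊b⌋₊).filter Nat.Prime, w p ≤
      Real.exp ε * (2 * ε * x * |nuFun c 1 α| / Real.log (boundB x c ε α)) := by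
  set ν := |nuFun c 1 α| with hν
  set g := etaTail c α with hg
  have hν0 : 0 ≤ ν := abs_nonneg _
  have hνg : ν ≤ g := by
    rw [hν, abs_nuFun_one hc hα₀ hα₁.le]
    exact integral_etaTail_le hc hα₀ hα₁.le
  have hBdef : boundB x c ε α = ε * x * Real.exp (-ε) * ν / (2 * g) := by
    rw [boundB, rightLim_muFun_one c hα₀]
  -- If `g` were 0, the quotient defining `B` would be 0 by convention, against `B > 1`.
  have hg0 : 0 < g := by
    refine lt_of_le_of_ne (etaTail_nonneg hc α) fun h => ?_
    rw [hBdef, ← h] at hB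
    norm_num at hB
  set V := Real.exp ε * (ε * x * ν) with hV
  -- The effective length of the interval, integral bound over maximum; the sieve is homogeneous in
  -- the weight, so only this ratio matters for the level.
  set y := V / g with hy
  have hlogB : 0 < Real.log (boundB x c ε α) := Real.log_pos hB
  have hyB : y / 2 = Real.exp (2 * ε) * boundB x c ε α := by
    have h1 : Real.exp (2 * ε) * Real.exp (-ε) = Real.exp ε := by
      rw [← Real.exp_add]
      ring_nf
    rw [hBdef, hy, hV, ← h1]
    field_simp
  have he1 : 1 ≤ Real.exp (2 * ε) := Real.one_le_exp (by linarith)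
  have hBy : boundB x c ε α ≤ y / 2 := by
    rw [hyB]
    nlinarith
  have hy2 : 2 < y := by linarith
  -- Needed so that the level, at most 7 or `√y`, stays below every prime being sieved.
  have hyx : y ≤ x := by
    have h1 : Real.exp ε ≤ 1 / (1 - ε) := Real.exp_bound_div_one_sub_of_interval hε₀.le (by linarith)
    have h2 : Real.exp ε ≤ 2 := h1.trans (by rw [div_le_iff₀ (by linarith)]; linarith)
    rw [hy, div_le_iff₀ hg0, hV]
    have h3 : ε * x * ν ≤ 1 / 100 * x * g := by gcongr
    calc Real.exp ε * (ε * x * ν) ≤ 2 * (1 / 100 * x * g) := by gcongr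
      _ ≤ x * g := by nlinarith [mul_pos (by linarith : (0 : ℝ) < x) hg0]
  obtain ⟨N, hN1, hN, hsel⟩ := exists_selberg_level hy2
  have hNa : (N : ℝ) < a := by
    have h1 : √y ≤ √x := Real.sqrt_le_sqrt hyx
    have h2 : √x < 0.99 * x := by
      rw [Real.sqrt_lt' (by linarith)]
      nlinarith
    rcases hN with h | h <;> linarith
  have hprimes : ∑ p ∈ (Finset.Icc 1 ⌊b⌋₊).filter Nat.Prime, w p
      = ∑ p ∈ ((Finset.Icc 1 ⌊b⌋₊).filter Nat.Prime).filter (fun p : ℕ => a ≤ p), w p := by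
    symm
    refine Finset.sum_filter_of_ne fun p _ h => (hsupp _ h).1
  rw [hprimes]
  have hsieve := sum_primes_le_selberg hN1 hw0 hsupp hdisc
    (((Finset.Icc 1 ⌊b⌋₊).filter Nat.Prime).filter (fun p : ℕ => a ≤ p)) (fun p hp => by
      obtain ⟨hp1, hp2⟩ := Finset.mem_filter.mp hp
      refine ⟨(Finset.mem_filter.mp hp1).2, by exact_mod_cast hNa.trans_le hp2, ?_⟩
      rintro rfl
      norm_num at hp2
      linarith)
  refine hsieve.trans ?_
  have hS := one_le_selbergMass hN1
  calc W / (2 * selbergMass N) + g * (sigmaTotientSum N / selbergMass N) ^ 2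
      ≤ V / (2 * selbergMass N) + g * (sigmaTotientSum N / selbergMass N) ^ 2 := by gcongr
    _ = g * (y / (2 * selbergMass N) + (sigmaTotientSum N / selbergMass N) ^ 2) := by
      rw [hy]
      field_simp
    _ ≤ g * (2 * y / Real.log (y / 2)) := by gcongr
    _ = 2 * V / Real.log (y / 2) := by
      rw [hy]
      field_simp
    _ ≤ 2 * V / Real.log (boundB x c ε α) := by
      have hV0 : 0 ≤ V := by positivity
      gcongr
    _ = _ := by
      rw [hV]
      ring

/-- Collects the exponential losses: `e^{ε/2}` from the kernel and `e^ε` from the integral of the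
weight together stay below `e^{2ε}`. The double logarithm comes from the number of exponents `m ≤
log b / log 2 ≤ log(2x²)`. -/
theorem exp_two_mul_bounds {x ε T : ℝ} (hx : 100 < x) (hε₀ : 0 < ε) (hε : ε < 1 / 100) {b : ℝ}
    (hb₁ : 1 < b) (hb : b ≤ Real.exp ε * x) {S : ℝ} (hT : 0 ≤ T) (hS : S ≤ Real.exp ε * T) :
    Real.exp (ε / 2) * (Real.log b * (S + 1 / 2 * ε * √b
        + 1 / 2 * Real.log (Real.log b / Real.log 2))) ≤
      Real.exp (2 * ε) * Real.log (Real.exp ε * x) *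
        (T + 2.01 * ε * √x + 1 / 2 * Real.log (Real.log (2 * x ^ 2))) := by
  have hlogb : 0 < Real.log b := Real.log_pos hb₁
  have hlog : Real.log b ≤ Real.log (Real.exp ε * x) := Real.log_le_log (by linarith) hb
  have hlogx : Real.log (Real.exp ε * x) = ε + Real.log x := by
    rw [Real.log_mul (Real.exp_ne_zero _) (by linarith), Real.log_exp]
  have hl2 := Real.log_two_gt_d9
  have hlx : 1 ≤ Real.log x := by
    rw [Real.le_log_iff_exp_le (by linarith)]
    have := Real.exp_one_lt_d9
    linarith
  have hsq : √b ≤ Real.exp (ε / 2) * √x := by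
    calc √b ≤ √(Real.exp ε * x) := Real.sqrt_le_sqrt hb
      _ = Real.exp (ε / 2) * √x := by rw [Real.sqrt_mul (Real.exp_pos _).le, Real.exp_half]
  have hll : Real.log b / Real.log 2 ≤ Real.log (2 * x ^ 2) := by
    rw [div_le_iff₀ (by linarith), Real.log_mul two_ne_zero (by positivity), Real.log_pow]
    push_cast
    nlinarith
  have hL1 : 1 ≤ Real.log (2 * x ^ 2) := by
    rw [Real.log_mul two_ne_zero (by positivity), Real.log_pow]
    push_cast
    linarith
  have hL0 : 0 ≤ Real.log (Real.log (2 * x ^ 2)) := Real.log_nonneg hL1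
  have hlll : Real.log (Real.log b / Real.log 2) ≤ Real.log (Real.log (2 * x ^ 2)) :=
    Real.log_le_log (by positivity) hll
  have he : 1 ≤ Real.exp ε := Real.one_le_exp hε₀.le
  have he2 : Real.exp (ε / 2) ≤ Real.exp ε := Real.exp_le_exp.mpr (by linarith)
  have hsx : 0 ≤ ε * √x := by positivity
  have hbr : S + 1 / 2 * ε * √b + 1 / 2 * Real.log (Real.log b / Real.log 2) ≤
      Real.exp ε * (T + 2.01 * ε * √x + 1 / 2 * Real.log (Real.log (2 * x ^ 2))) := by
    have h1 : ε * √b ≤ Real.exp ε * (ε * √x) := by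
      calc ε * √b ≤ ε * (Real.exp (ε / 2) * √x) := by gcongr
        _ ≤ ε * (Real.exp ε * √x) := by gcongr
        _ = _ := by ring
    have h2 : Real.log (Real.log (2 * x ^ 2)) ≤ Real.exp ε * Real.log (Real.log (2 * x ^ 2)) :=
      le_mul_of_one_le_left hL0 he
    have h3 : 0 ≤ Real.exp ε * (ε * √x) := by positivity
    have e1 : Real.exp ε * (T + 2.01 * ε * √x + 1 / 2 * Real.log (Real.log (2 * x ^ 2)))
        = Real.exp ε * T + 2.01 * (Real.exp ε * (ε * √x))
          + 1 / 2 * (Real.exp ε * Real.log (Real.log (2 * x ^ 2))) := by ring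
    rw [e1]
    norm_num at h3 ⊢
    linarith
  have hR0 : 0 ≤ T + 2.01 * ε * √x + 1 / 2 * Real.log (Real.log (2 * x ^ 2)) := by
    have : 0 ≤ 2.01 * ε * √x := by positivity
    linarith
  have hee : Real.exp (2 * ε) = Real.exp ε * Real.exp ε := by
    rw [← Real.exp_add]
    ring_nf
  calc Real.exp (ε / 2) * (Real.log b * (S + 1 / 2 * ε * √b
        + 1 / 2 * Real.log (Real.log b / Real.log 2)))
      ≤ Real.exp (ε / 2) * (Real.log b * (Real.exp ε *
        (T + 2.01 * ε * √x + 1 / 2 * Real.log (Real.log (2 * x ^ 2))))) := by gcongr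
    _ ≤ Real.exp ε * (Real.log (Real.exp ε * x) * (Real.exp ε *
        (T + 2.01 * ε * √x + 1 / 2 * Real.log (Real.log (2 * x ^ 2))))) := by gcongr
    _ = _ := by
      rw [hee]
      ring

/-- The weight `η`-tail at `σ log(t / x) / ε`, restricted to an interval `[a, b]`. -/
noncomputable def shortWeight (x c ε σ a b : ℝ) : ℝ → ℝ :=
  (Icc a b).indicator fun t => etaTail c (σ * (Real.log t - Real.log x) / ε)

theorem shortWeight_nonneg {c : ℝ} (hc : 0 < c) (x ε σ a b t : ℝ) :
    0 ≤ shortWeight x c ε σ a b t :=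
  indicator_nonneg (fun _ _ => etaTail_nonneg hc _) t

theorem mem_of_shortWeight_ne_zero {x c ε σ a b t : ℝ} (h : shortWeight x c ε σ a b t ≠ 0) :
    a ≤ t ∧ t ≤ b :=
  (mem_of_indicator_ne_zero h : t ∈ Icc a b)

theorem shortWeight_of_mem {x c ε σ a b t : ℝ} (h : t ∈ Icc a b) :
    shortWeight x c ε σ a b t = etaTail c (σ * (Real.log t - Real.log x) / ε) :=
  indicator_of_mem h _

theorem shortWeight_of_notMem {x c ε σ a b t : ℝ} (h : t ∉ Icc a b) :
    shortWeight x c ε σ a b t = 0 :=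
  indicator_of_notMem h _

theorem integral_shortWeight (x c ε σ : ℝ) {a b : ℝ} (hab : a ≤ b) :
    ∫ t, shortWeight x c ε σ a b t =
      ∫ t in a..b, etaTail c (σ * (Real.log t - Real.log x) / ε) := by
  rw [shortWeight, integral_indicator measurableSet_Icc, integral_Icc_eq_integral_Ioc,
    intervalIntegral.integral_of_le hab]

theorem shortWeight_le {c x ε σ a b α : ℝ} (hc : 0 < c)
    (h : ∀ t ∈ Icc a b, α ≤ σ * (Real.log t - Real.log x) / ε) (t : ℝ) :
    shortWeight x c ε σ a b t ≤ etaTail c α := by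
  by_cases ht : t ∈ Icc a b
  · rw [shortWeight_of_mem ht]
    exact etaTail_antitone hc (h t ht)
  · rw [shortWeight_of_notMem ht]
    exact etaTail_nonneg hc α

/-- The weighted sum over prime powers in a short interval at distance at least `e^{±αε}`
from `x`. -/
theorem tsum_shortWeight_le {x c ε α : ℝ} (hc : 0 < c) (hα₀ : 0 ≤ α) (hα₁ : α < 1)
    (hx : 100 < x) (hε₀ : 0 < ε) (hε : ε < 1 / 100) (hB : 1 < boundB x c ε α) {σ a b : ℝ}
    (ha : Real.exp (-ε) * x ≤ a) (hab : a ≤ b) (hb : b ≤ Real.exp ε * x)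
    (hba : b ≤ Real.exp ε * a)
    (hα : ∀ t ∈ Icc a b, α ≤ σ * (Real.log t - Real.log x) / ε)
    (hW : ∫ t, shortWeight x c ε σ a b t ≤ Real.exp ε * (ε * x * |nuFun c 1 α|))
    (hdisc : ∀ D : ℕ, 0 < D →
      |∑' k : ℤ, shortWeight x c ε σ a b (((D * (2 * k + 1) : ℤ)) : ℝ)
        - (∫ t, shortWeight x c ε σ a b t) / 2 * (1 / D)| ≤ etaTail c α) :
    Real.exp (ε / 2) * ∑' q : Nat.Primes × ℕ+,
      Real.log (q.1 : ℝ) * shortWeight x c ε σ a b ((q.1 : ℝ) ^ (q.2 : ℕ)) ≤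
        boundA x c ε α := by
  have ha' : 0.99 * x ≤ a := by
    have h1 := Real.add_one_le_exp (-ε)
    have h2 : 0.99 * x ≤ Real.exp (-ε) * x := by
      gcongr
      norm_num at hε ⊢
      linarith
    linarith
  -- Half the mass of the even density `η` lies to the right of 0, and `α ≥ 0`.
  have hhalf : ∀ t, shortWeight x c ε σ a b t ≤ 1 / 2 := fun t =>
    (shortWeight_le hc hα t).trans ((etaTail_antitone hc hα₀).trans_eq (etaTail_zero hc))
  have hsum := tsum_primePow_le (by linarith) hab hba (shortWeight_nonneg hc x ε σ a b) hhalf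
    (fun t => mem_of_shortWeight_ne_zero)
  have hprimes := sum_primes_weight_le hc hα₀ hα₁ hx hε₀ hε hB ha'
    (shortWeight_nonneg hc x ε σ a b) (fun t => mem_of_shortWeight_ne_zero) hdisc hW
  have hlogB := Real.log_pos hB
  refine (mul_le_mul_of_nonneg_left hsum (Real.exp_pos _).le).trans ?_
  exact exp_two_mul_bounds hx hε₀ hε (by linarith) hb (by positivity) hprimes

theorem tsum_upper_shortWeight_le {x c ε α : ℝ} (hc : 0 < c) (hα₀ : 0 ≤ α) (hα₁ : α < 1)
    (hx : 100 < x) (hε₀ : 0 < ε) (hε : ε < 1 / 100) (hB : 1 < boundB x c ε α) :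
    Real.exp (ε / 2) * ∑' q : Nat.Primes × ℕ+, Real.log (q.1 : ℝ) *
      shortWeight x c ε 1 (Real.exp (α * ε) * x) (Real.exp ε * x) ((q.1 : ℝ) ^ (q.2 : ℕ)) ≤
        boundA x c ε α := by
  have hx0 : 0 < x := by linarith
  have hαε : α * ε ≤ ε := by nlinarith
  have hαε0 : 0 ≤ α * ε := by positivity
  have ha0 : 0 < Real.exp (α * ε) * x := by positivity
  have hab : Real.exp (α * ε) * x ≤ Real.exp ε * x := by gcongr
  have hα : ∀ t ∈ Icc (Real.exp (α * ε) * x) (Real.exp ε * x),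
      α ≤ 1 * (Real.log t - Real.log x) / ε := by
    intro t ht
    have h1 := Real.log_le_log ha0 ht.1
    rw [Real.log_mul (Real.exp_ne_zero _) hx0.ne', Real.log_exp] at h1
    rw [le_div_iff₀ hε₀]
    linarith
  refine tsum_shortWeight_le hc hα₀ hα₁ hx hε₀ hε hB ?_ hab le_rfl ?_ hα ?_ ?_
  · gcongr
    linarith
  · gcongr
    exact le_mul_of_one_le_left hx0.le (Real.one_le_exp hαε0)
  · have h := integral_etaTail_log c hx0 hε₀ (σ := 1) (by norm_num) α
    rw [integral_shortWeight x c ε 1 hab, abs_nuFun_one hc hα₀ hα₁.le]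
    have e1 : x * Real.exp (1 * (ε * α)) = Real.exp (α * ε) * x := by ring_nf
    have e2 : x * Real.exp (1 * (ε * 1)) = Real.exp ε * x := by ring_nf
    rw [e1, e2] at h
    rw [h]
    have := integral_etaTail_mul_exp_le hc hε₀ (σ := 1) le_rfl hα₀ hα₁.le
    calc 1 * (ε * x) * ∫ s in α..1, etaTail c s * Real.exp (1 * (ε * s))
        ≤ 1 * (ε * x) * (Real.exp ε * ∫ s in α..1, etaTail c s) := by gcongr
      _ = _ := by ring
  · intro D hD
    -- Above `x` the weight jumps up at the left end and then decreases, also through the cut at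
    -- `e^ε x`.
    refine abs_tsum_odd_multiples_sub_le_of_antitoneOn (a := Real.exp (α * ε) * x)
      (b := Real.exp ε * x) ?_ ?_ ?_ (shortWeight_le hc hα) hD
    · intro s hs t ht hst
      by_cases htb : t ≤ Real.exp ε * x
      · rw [shortWeight_of_mem ⟨hs, hst.trans htb⟩, shortWeight_of_mem ⟨ht, htb⟩]
        refine etaTail_antitone hc ?_
        have := Real.log_le_log (ha0.trans_le hs) hst
        gcongr
      · rw [shortWeight_of_notMem fun h => htb h.2]
        exact shortWeight_nonneg hc _ _ _ _ _ _
    · exact fun t ht => shortWeight_of_notMem fun h => absurd h.1 (not_le.mpr ht)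
    · exact fun t ht => shortWeight_of_notMem fun h => absurd h.2 (not_le.mpr ht)

theorem tsum_lower_shortWeight_le {x c ε α : ℝ} (hc : 0 < c) (hα₀ : 0 ≤ α) (hα₁ : α < 1)
    (hx : 100 < x) (hε₀ : 0 < ε) (hε : ε < 1 / 100) (hB : 1 < boundB x c ε α) :
    Real.exp (ε / 2) * ∑' q : Nat.Primes × ℕ+, Real.log (q.1 : ℝ) *
      shortWeight x c ε (-1) (Real.exp (-ε) * x) (Real.exp (-(α * ε)) * x)
        ((q.1 : ℝ) ^ (q.2 : ℕ)) ≤ boundA x c ε α := by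
  have hx0 : 0 < x := by linarith
  have hαε : α * ε ≤ ε := by nlinarith
  have hαε0 : 0 ≤ α * ε := by positivity
  have ha0 : 0 < Real.exp (-ε) * x := by positivity
  have hab : Real.exp (-ε) * x ≤ Real.exp (-(α * ε)) * x := by gcongr
  have hbx : Real.exp (-(α * ε)) * x ≤ x :=
    mul_le_of_le_one_left hx0.le (Real.exp_le_one_iff.mpr (by linarith))
  have hα : ∀ t ∈ Icc (Real.exp (-ε) * x) (Real.exp (-(α * ε)) * x),
      α ≤ -1 * (Real.log t - Real.log x) / ε := by
    intro t ht
    have h1 := Real.log_le_log (ha0.trans_le ht.1) ht.2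
    rw [Real.log_mul (Real.exp_ne_zero _) hx0.ne', Real.log_exp] at h1
    rw [le_div_iff₀ hε₀]
    linarith
  refine tsum_shortWeight_le hc hα₀ hα₁ hx hε₀ hε hB le_rfl hab ?_ ?_ hα ?_ ?_
  · exact hbx.trans (le_mul_of_one_le_left hx0.le (Real.one_le_exp hε₀.le))
  · rw [← mul_assoc, ← Real.exp_add, add_neg_cancel, Real.exp_zero, one_mul]
    exact hbx
  · have h := integral_etaTail_log c hx0 hε₀ (σ := -1) (by norm_num) α
    rw [integral_shortWeight x c ε (-1) hab, abs_nuFun_one hc hα₀ hα₁.le]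
    have e1 : x * Real.exp (-1 * (ε * α)) = Real.exp (-(α * ε)) * x := by ring_nf
    have e2 : x * Real.exp (-1 * (ε * 1)) = Real.exp (-ε) * x := by ring_nf
    rw [e1, e2] at h
    rw [intervalIntegral.integral_symm, h]
    have := integral_etaTail_mul_exp_le hc hε₀ (σ := -1) (by norm_num) hα₀ hα₁.le
    calc -(-1 * (ε * x) * ∫ s in α..1, etaTail c s * Real.exp (-1 * (ε * s)))
        = ε * x * ∫ s in α..1, etaTail c s * Real.exp (-1 * (ε * s)) := by ring
      _ ≤ ε * x * (Real.exp ε * ∫ s in α..1, etaTail c s) := by gcongr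
      _ = _ := by ring
  · intro D hD
    -- Below `x` the picture is mirrored: the weight increases up to the right end and then drops to
    -- 0.
    refine abs_tsum_odd_multiples_sub_le_of_monotoneOn (a := Real.exp (-ε) * x)
      (b := Real.exp (-(α * ε)) * x) ?_ ?_ ?_ (shortWeight_le hc hα) hD
    · intro s hs t ht hst
      by_cases hsa : Real.exp (-ε) * x ≤ s
      · rw [shortWeight_of_mem ⟨hsa, hs⟩, shortWeight_of_mem ⟨hsa.trans hst, ht⟩]
        refine etaTail_antitone hc ?_
        have := Real.log_le_log (ha0.trans_le hsa) hst
        gcongr ?_ / ε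
        linarith
      · rw [shortWeight_of_notMem fun h => hsa h.1]
        exact shortWeight_nonneg hc _ _ _ _ _ _
    · exact fun t ht => shortWeight_of_notMem fun h => absurd h.1 (not_le.mpr ht)
    · exact fun t ht => shortWeight_of_notMem fun h => absurd h.2 (not_le.mpr ht)

theorem etaKernel_eq_zero {c ε u : ℝ} (hc : 0 < c) (hε : 0 < ε) (hu : ε ≤ u) :
    etaKernel c ε u = 0 := by
  refine le_antisymm ((etaKernel_le hc hε (hε.le.trans hu)).trans_eq ?_)
    (etaKernel_nonneg hc hε u)
  exact etaTail_eq_zero c ((one_le_div hε).mpr hu)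

end

/-! ### Termwise comparison of the sharp and the smoothed cutoff -/

open MeasureTheory Set in
theorem mainTheorem5 (x c ε α : ℝ) (hc : 0 < c) (hα₀ : 0 ≤ α) (hα₁ : α < 1)
    (hx : 100 < x) (hε₀ : 0 < ε) (hε : ε < 1 / 100) (hB : 1 < boundB x c ε α) :
    psiStar (Real.exp (-(α * ε)) * x) ≤ psiMod c ε x + boundA x c ε α ∧
      psiMod c ε x - boundA x c ε α ≤ psiStar (Real.exp (α * ε) * x) := by
  have hx0 : 0 < x := by linarith
  have hn0 : ∀ q : Nat.Primes × ℕ+, (0 : ℝ) < (q.1 : ℝ) ^ (q.2 : ℕ) := fun q => by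
    have : (0 : ℝ) < (q.1 : ℝ) := by exact_mod_cast q.1.2.pos
    positivity
  have hlog0 : ∀ q : Nat.Primes × ℕ+, 0 ≤ Real.log (q.1 : ℝ) := fun q =>
    Real.log_natCast_nonneg _
  have hlogX : ∀ y : ℝ, Real.log (Real.exp y * x) = y + Real.log x := fun y => by
    rw [Real.log_mul (Real.exp_ne_zero _) hx0.ne', Real.log_exp]
  have hsumStar : ∀ X : ℝ, 0 ≤ X → Summable fun q : Nat.Primes × ℕ+ =>
      chiStar (Icc 0 X) ((q.1 : ℝ) ^ (q.2 : ℕ)) * Real.log (q.1 : ℝ) := fun X hX =>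
    summable_of_primePow_le X fun q hq => by
      rw [chiStar_Icc_of_notMem hX fun h => absurd h.2 (not_le.mpr hq), zero_mul]
  have hsumMod : Summable fun q : Nat.Primes × ℕ+ => Real.log (q.1 : ℝ) *
      etaKernel c ε (Real.log ((q.1 : ℝ) ^ (q.2 : ℕ)) - Real.log x) :=
    summable_of_primePow_le (Real.exp ε * x) fun q hq => by
      have h := Real.log_le_log (by positivity) hq.le
      rw [hlogX] at h
      rw [etaKernel_eq_zero hc hε₀ (by linarith), mul_zero]
  have hsumW : ∀ σ a b : ℝ, Summable fun q : Nat.Primes × ℕ+ => Real.log (q.1 : ℝ) *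
      shortWeight x c ε σ a b ((q.1 : ℝ) ^ (q.2 : ℕ)) := fun σ a b =>
    summable_of_primePow_le b fun q hq => by
      rw [shortWeight_of_notMem fun h => absurd h.2 (not_le.mpr hq), mul_zero]
  have he1 : 1 ≤ Real.exp (ε / 2) := Real.one_le_exp (by linarith)
  have hαε0 : 0 ≤ α * ε := by positivity
  rw [psiMod_eq x c hε₀ (by linarith)]
  constructor
  · refine le_trans ?_ (add_le_add_right
      (tsum_lower_shortWeight_le hc hα₀ hα₁ hx hε₀ hε hB) _)
    rw [psiStar, ← tsum_mul_left, ← hsumMod.tsum_add ((hsumW _ _ _).mul_left _)]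
    refine (hsumStar _ (by positivity)).tsum_le_tsum (fun q => ?_)
      (hsumMod.add ((hsumW _ _ _).mul_left _))
    set n := (q.1 : ℝ) ^ (q.2 : ℕ) with hn
    have hn' : 0 < n := hn0 q
    set u := Real.log n - Real.log x with hu
    have hw0 := shortWeight_nonneg hc x ε (-1) (Real.exp (-ε) * x) (Real.exp (-(α * ε)) * x) n
    -- On the short interval `1 - K` is paid for by the weight; below it the tail argument is at
    -- least 1, so `K ≥ 1`; above it the cutoff vanishes.
    have hkey : chiStar (Icc 0 (Real.exp (-(α * ε)) * x)) n ≤ etaKernel c ε u +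
        Real.exp (ε / 2) *
          shortWeight x c ε (-1) (Real.exp (-ε) * x) (Real.exp (-(α * ε)) * x) n := by
      have hK0 := etaKernel_nonneg hc hε₀ u
      have hK := one_sub_etaKernel_le hc hε₀ u
      by_cases h1 : n ≤ Real.exp (-(α * ε)) * x
      · refine (chiStar_le_one _ _).trans ?_
        by_cases h2 : Real.exp (-ε) * x ≤ n
        · rw [shortWeight_of_mem ⟨h2, h1⟩, neg_one_mul]
          linarith
        · have h := Real.log_le_log hn' (not_le.mp h2).le
          rw [hlogX] at h
          rw [etaTail_eq_zero c ((one_le_div hε₀).mpr (by linarith))] at hK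
          nlinarith
      · rw [chiStar_Icc_of_notMem (by positivity) fun h => h1 h.2]
        positivity
    calc _ ≤ (etaKernel c ε u + Real.exp (ε / 2) * shortWeight x c ε (-1) (Real.exp (-ε) * x)
          (Real.exp (-(α * ε)) * x) n) * Real.log (q.1 : ℝ) :=
        mul_le_mul_of_nonneg_right hkey (hlog0 q)
      _ = _ := by ring
  · rw [sub_le_iff_le_add]
    refine le_trans ?_ (add_le_add_right
      (tsum_upper_shortWeight_le hc hα₀ hα₁ hx hε₀ hε hB) _)
    rw [psiStar, ← tsum_mul_left,
      ← (hsumStar _ (by positivity)).tsum_add ((hsumW _ _ _).mul_left _)]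
    refine hsumMod.tsum_le_tsum (fun q => ?_)
      ((hsumStar _ (by positivity)).add ((hsumW _ _ _).mul_left _))
    set n := (q.1 : ℝ) ^ (q.2 : ℕ) with hn
    have hn' : 0 < n := hn0 q
    set u := Real.log n - Real.log x with hu
    have hw0 := shortWeight_nonneg hc x ε 1 (Real.exp (α * ε) * x) (Real.exp ε * x) n
    -- Strictly below `e^{αε} x` the cutoff is 1 and `K ≤ 1`. The endpoint, where the cutoff is only
    -- `1/2`, belongs to the closed short interval, whose weight alone dominates `K`; beyond `e^ε x`
    -- one has `K = 0`.
    have hkey : etaKernel c ε u ≤ chiStar (Icc 0 (Real.exp (α * ε) * x)) n +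
        Real.exp (ε / 2) *
          shortWeight x c ε 1 (Real.exp (α * ε) * x) (Real.exp ε * x) n := by
      have hχ := chiStar_nonneg (Icc 0 (Real.exp (α * ε) * x)) n
      by_cases h1 : n < Real.exp (α * ε) * x
      · rw [chiStar_Icc_of_mem_Ioo ⟨hn', h1⟩]
        have := etaKernel_le_one hc hε₀ u
        nlinarith
      · have h := Real.log_le_log (by positivity) (not_lt.mp h1)
        rw [hlogX] at h
        by_cases h2 : n ≤ Real.exp ε * x
        · have hK := etaKernel_le hc hε₀ (show 0 ≤ u by linarith)
          rw [shortWeight_of_mem ⟨not_lt.mp h1, h2⟩, one_mul] at hw0 ⊢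
          nlinarith
        · have h' := Real.log_le_log (by positivity) (not_le.mp h2).le
          rw [hlogX] at h'
          rw [etaKernel_eq_zero hc hε₀ (by linarith)]
          positivity
    calc _ ≤ Real.log (q.1 : ℝ) * (chiStar (Icc 0 (Real.exp (α * ε) * x)) n + Real.exp (ε / 2) *
          shortWeight x c ε 1 (Real.exp (α * ε) * x) (Real.exp ε * x) n) :=
        mul_le_mul_of_nonneg_left hkey (hlog0 q)
      _ = _ := by ring
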